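/- Let $g,\ell\ge 1$, let $\langle x\rangle$ be the set of words in noncommuting letters $x_1,\dots,x_g$ (with empty word $\emptyset$; $\alpha^*$ is the reversed word and $|\alpha|$ the length of $\alpha$), and let $\mathbb C\langle x\rangle$ be the free algebra with the involution that conjugates coefficients, reverses words and fixes the $x_j$. Let $p=\sum_{|\gamma|\le\deg p}p_\gamma\gamma$ be a symmetric $\ell\times\ell$ matrix polynomial over $\mathbb C\langle x\rangle$ ($p^*=p$). Suppose $p$ is archimedean: for some $K>0$ there are finitely many matrix polynomials $s_j$ and $f_j$, where the $s_j$ have one column and the $f_j$ have size $\ell\times 1$, such that $K^2-\sum_j x_j^2=\sum_j s_j^*s_j+\sum_j f_j^*pf_j$. Let $\mathbb S_n$ be the set of self-adjoint complex $n\times n$ matrices. For positive integers $n$ and integers $d\ge0$ define the following. * $\mathrm{co}^{\mathrm{oper}}\mathcal D_p(n)$ is the set of $X\in\mathbb S_n^g$ such that $X_j=V^*Z_jV$ for all $j$, for some tuple $Z=(Z_1,\dots,Z_g)$ of bounded self-adjoint operators on a separable complex Hilbert space $H$ with $p(Z)\succeq0$ and some isometry $V:\mathbb C^n\to H$. * $\mathcal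 L_p(n)$ is the set of sequences $Y=(Y_\alpha)_{\alpha\in\langle x\rangle}$ of complex $n\times n$ matrices with $Y_\emptyset=I$, $Y_{\alpha^*}=Y_\alpha^*$ for all $\alpha$, $(Y_{\alpha^*\beta})_{\alpha,\beta}\succeq0$ and $\big(\sum_\gamma p_\gamma\otimes Y_{\alpha^*\gamma\beta}\big)_{\alpha,\beta}\succeq0$; and $\hat{\mathcal L}_p(n)=\{(Y_{x_1},\dots,Y_{x_g}):Y\in\mathcal L_p(n)\}$. * $\mathcal L_p(n;d)$ is the set of truncated sequences $(Y_\alpha)_{|\alpha|\le 2d+\deg p+1}$ of complex $n\times n$ matrices with $Y_\emptyset=I$, $Y_{\alpha^*}=Y_\alpha^*$ for all these $\alpha$, $(Y_{\alpha^*\beta})_{|\alpha|,|\beta|\le d+\lceil\frac12\deg p\rceil}\succeq0$ and $\big(\sum_\gamma p_\gamma\otimes Y_{\alpha^*\gamma\beta}\big)_{|\alpha|,|\beta|\le d}\succeq0$; and $\hat{\mathcal L}_p(n;d)=\{(Y_{x_1},\dots,Y_{x_g}):Y\in\mathcal L_p(n;d)\}$. * For a word $\sigma$, $E^{(d)}_\sigma$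 is the direct sum of the matrix with rows and columns indexed by $|\alpha|,|\beta|\le d+\lceil\frac12\deg p\rceil$ and entries $1$ if $\alpha^*\beta=\sigma$, $0$ otherwise, and the block matrix indexed by $|\alpha|,|\beta|\le d$ with $\ell\times\ell$ blocks $\sum_{\gamma:\,\alpha^*\gamma\beta=\sigma}p_\gamma$. $L_d$ is the linear pencil, with self-adjoint coefficients of finite size independent of $n$, in the variables $x_j$ and $u_\sigma,v_\sigma$ ($2\le|\sigma|\le 2d+\deg p+1$) given by $$L_d=E^{(d)}_\emptyset+\sum_{j=1}^gE^{(d)}_{x_j}x_j+\sum_\sigma\Big(\tfrac12\big(E^{(d)}_\sigma+(E^{(d)}_\sigma)^*\big)u_\sigma+\tfrac i2\big(E^{(d)}_\sigma-(E^{(d)}_\sigma)^*\big)v_\sigma\Big).$$ A linear pencil $L=A_0+\sum_iA_iz_i$ is evaluated at a tuple $Z$ of self-adjoint $n\times n$ matrices as $L(Z)=A_0\otimes I+\sum_iA_i\otimes Z_i$, and $\mathcal D_L(n)$ is the set of such $Z$ with $L(Z)\succeq0$. A free spectrahedrop is a sequence of sets $(\Gamma(n))_n$ for which there is one linear pencil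 $L$, of finite size and in finitely many variables $x_1,\dots,x_g,y_1,\dots,y_h$, such that for all $n$ the set $\Gamma(n)$ is the projection of $\mathcal D_L(n)$ onto the $x$-variables. Then: 1. $\mathrm{co}^{\mathrm{oper}}\mathcal D_p(n)=\hat{\mathcal L}_p(n)$ for each $n$. 2. $\bigcap_{d\ge0}\hat{\mathcal L}_p(n;d)=\mathrm{co}^{\mathrm{oper}}\mathcal D_p(n)$ for each $n$. 3. For each $d$ and $n$, $\hat{\mathcal L}_p(n;d)$ is the projection of $\mathcal D_{L_d}(n)$ onto the $x$-variables; in particular $\hat{\mathcal L}_p(\,\cdot\,;d)$ is a free spectrahedrop. 4. $\mathrm{co}^{\mathrm{oper}}\mathcal D_p(n)\subseteq\hat{\mathcal L}_p(n;d)$ for all $d$ and $n$, and $\hat{\mathcal L}_p(n;d+1)\subseteq\hat{\mathcal L}_p(n;d)$ for all $d$ and $n$. -/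

import Mathlib

open scoped Kronecker ComplexOrder InnerProductSpace Matrix

noncomputable section

namespace FreeHull

/-! ### Words and free polynomials -/

/-- The words in the letters `x_1, …, x_g`; `1` is the empty word and `star` reverses a word. -/
abbrev Word (g : ℕ) : Type := FreeMonoid (Fin g)

instance instDecidableEqWord (g : ℕ) : DecidableEq (Word g) :=
  inferInstanceAs (DecidableEq (List (Fin g)))

/-- The free algebra `ℂ⟨x⟩`, realized as the monoid algebra of the words. -/
abbrev FreePoly (g : ℕ) : Type := MonoidAlgebra ℂ (Word g)

/-- The involution of `ℂ⟨x⟩`: it conjugates the coefficients, reverses the words and fixes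
the letters. -/
def freeStar {g : ℕ} (q : FreePoly g) : FreePoly g :=
  MonoidAlgebra.ofCoeff
    (Finsupp.mapDomain star (Finsupp.mapRange (starRingEnd ℂ) (map_zero _) q.coeff))

theorem freeStar_single {g : ℕ} (w : Word g) (c : ℂ) :
    freeStar (MonoidAlgebra.single w c) = MonoidAlgebra.single (star w) (starRingEnd ℂ c) := by
  simp [freeStar, Finsupp.mapDomain_single]

theorem freeStar_zero {g : ℕ} : freeStar (0 : FreePoly g) = 0 := by
  simp [freeStar]

theorem freeStar_add {g : ℕ} (a b : FreePoly g) : freeStar (a + b) = freeStar a + freeStar b := by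
  simp only [freeStar, MonoidAlgebra.coeff_add]
  rw [Finsupp.mapRange_add (map_add (starRingEnd ℂ)), Finsupp.mapDomain_add]
  rfl

theorem freeStar_coeff {g : ℕ} (q : FreePoly g) (w : Word g) :
    (freeStar q).coeff w = starRingEnd ℂ (q.coeff (star w)) := by
  have h := Finsupp.mapDomain_apply (star_injective (R := Word g))
    (Finsupp.mapRange (starRingEnd ℂ) (map_zero _) q.coeff) (star w)
  rw [star_star] at h
  simpa [freeStar] using h

instance instStarRingFreePoly {g : ℕ} : StarRing (FreePoly g) where
  star := freeStar
  star_involutive q := by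
    apply MonoidAlgebra.ext
    ext w
    simp [freeStar_coeff]
  star_add := freeStar_add
  star_mul a b := by
    induction a using MonoidAlgebra.induction_linear with
    | zero => simp [freeStar_zero]
    | add a a' ha ha' => rw [add_mul, freeStar_add, ha, ha', freeStar_add, mul_add]
    | single w c =>
      induction b using MonoidAlgebra.induction_linear with
      | zero => simp [freeStar_zero]
      | add b b' hb hb' => rw [mul_add, freeStar_add, hb, hb', freeStar_add, add_mul]
      | single v e =>
        simp [freeStar_single, MonoidAlgebra.single_mul_single, star_mul, mul_comm]

/-- The letter `x_j` as a free polynomial. -/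
def letter {g : ℕ} (j : Fin g) : FreePoly g := MonoidAlgebra.of ℂ (Word g) (FreeMonoid.of j)

/-- Free matrix polynomials: `ℓ × ν` matrices with entries in `ℂ⟨x⟩`.  The involution is the
conjugate transpose `Pᴴ` (with respect to the involution of `ℂ⟨x⟩`), and a square `P` is symmetric
when `P.IsHermitian`. -/
abbrev MatPoly (g ℓ ν : ℕ) : Type := Matrix (Fin ℓ) (Fin ν) (FreePoly g)

/-- The matrix coefficient `P_w` in `P = ∑ w, P_w w`. -/
def wcoeff {g ℓ ν : ℕ} (P : MatPoly g ℓ ν) (w : Word g) : Matrix (Fin ℓ) (Fin ν) ℂ :=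
  Matrix.of fun i j => (P i j).coeff w

/-- The degree of a matrix polynomial: the length of its longest word (`0` for `P = 0`). -/
def degree {g ℓ ν : ℕ} (P : MatPoly g ℓ ν) : ℕ :=
  Finset.univ.sup fun i => Finset.univ.sup fun j => (P i j).coeff.support.sup FreeMonoid.length

/-- The words of length at most `N`. -/
abbrev TruncWord (g N : ℕ) : Type := {w : Word g // w.length ≤ N}

instance instFintypeTruncWord (g N : ℕ) : Fintype (TruncWord g N) :=
  (List.finite_length_le (Fin g) N).fintype

theorem length_star {g : ℕ} (w : Word g) : (star w).length = w.length :=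
  List.length_reverse

/-- `p` is archimedean: `K² - ∑ x_j² = ∑ s_j^* s_j + ∑ f_j^* p f_j` for some `K > 0` and finitely
many matrix polynomials `s_j`, `f_j`. -/
def IsArchimedean {g ℓ : ℕ} (p : MatPoly g ℓ ℓ) : Prop :=
  ∃ K : ℝ, 0 < K ∧ ∃ (a b t : ℕ) (s : Fin a → MatPoly g t 1) (f : Fin b → MatPoly g ℓ 1),
    Matrix.scalar (Fin 1) (((K : ℂ) ^ 2) • (1 : FreePoly g) - ∑ j, letter j ^ 2) =
      ∑ i, (s i)ᴴ * s i + ∑ i, (f i)ᴴ * p * f i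

/-! ### The operator convex hull -/

/-- A family `(Γ(n))_n` of sets of `g`-tuples of `n × n` matrices. -/
abbrev FreeFamily (g : ℕ) : Type := ∀ n : ℕ, Set (Fin g → Matrix (Fin n) (Fin n) ℂ)

/-- The evaluation `q(Z)` of a free polynomial at a tuple of bounded operators. -/
def evalOper {g : ℕ} {H : Type} [NormedAddCommGroup H] [InnerProductSpace ℂ H]
    (Z : Fin g → H →L[ℂ] H) (q : FreePoly g) : H →L[ℂ] H :=
  MonoidAlgebra.lift ℂ (H →L[ℂ] H) (Word g) (FreeMonoid.lift Z) q

/-- The operator free semialgebraic set of `p` on `H`: the tuples `Z` of bounded self-adjoint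
operators on `H` such that `p(Z) = (p_{ab}(Z))_{a,b}` is a positive operator on `H^ℓ`. -/
def operSemialg {g ℓ : ℕ} (p : MatPoly g ℓ ℓ) (H : Type) [NormedAddCommGroup H]
    [InnerProductSpace ℂ H] [CompleteSpace H] : Set (Fin g → H →L[ℂ] H) :=
  {Z | (∀ j, IsSelfAdjoint (Z j)) ∧
    ∀ v : Fin ℓ → H, 0 ≤ ∑ a, ∑ b, ⟪v a, evalOper Z (p a b) (v b)⟫_ℂ}

/-- The operator convex hull: `X` belongs to it iff `X = V^* Z V` for some `Z` in the operator free
semialgebraic set of `p` on some separable Hilbert space `H` and some isometry `V : ℂⁿ → H`. -/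
def coOper {g ℓ : ℕ} (p : MatPoly g ℓ ℓ) : FreeFamily g := fun n =>
  {X | (∀ j, (X j).IsHermitian) ∧
    ∃ (H : Type) (_ : NormedAddCommGroup H) (_ : InnerProductSpace ℂ H) (_ : CompleteSpace H)
      (_ : TopologicalSpace.SeparableSpace H),
      ∃ Z ∈ operSemialg p H, ∃ V : EuclideanSpace ℂ (Fin n) →ₗᵢ[ℂ] H,
        ∀ j, Matrix.toEuclideanCLM (𝕜 := ℂ) (X j) =
          (ContinuousLinearMap.adjoint V.toContinuousLinearMap) ∘L (Z j) ∘L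
            V.toContinuousLinearMap}

/-! ### Moment sequences, Hankel matrices and the lift -/

/-- The free Hankel matrix `H(Y) = (Y_{α^* β})_{α,β}`; positive semidefiniteness of such an infinite
block matrix is tested on finitely supported vectors (`Matrix.PosSemidef`). -/
def hankel {g n : ℕ} (Y : Word g → Matrix (Fin n) (Fin n) ℂ) :
    Matrix (Word g × Fin n) (Word g × Fin n) ℂ :=
  Matrix.of fun r c => Y (star r.1 * c.1) r.2 c.2

/-- The `p`-localizing matrix, with `(α, β)` block `∑ γ, p_γ ⊗ Y_{α^* γ β}`. -/
def localizing {g ℓ n : ℕ} (p : MatPoly g ℓ ℓ) (Y : Word g → Matrix (Fin n) (Fin n) ℂ) :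
    Matrix (Word g × (Fin ℓ × Fin n)) (Word g × (Fin ℓ × Fin n)) ℂ :=
  Matrix.of fun r c =>
    (∑ γ : TruncWord g (degree p), wcoeff p γ.1 ⊗ₖ Y (star r.1 * γ.1 * c.1)) r.2 c.2

/-- The lift `L_p(n)`. -/
def lift {g ℓ : ℕ} (p : MatPoly g ℓ ℓ) (n : ℕ) : Set (Word g → Matrix (Fin n) (Fin n) ℂ) :=
  {Y | Y 1 = 1 ∧ (∀ α, Y (star α) = (Y α)ᴴ) ∧ (hankel Y).PosSemidef ∧ (localizing p Y).PosSemidef}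

/-- The projected lift: the set of the tuples `(Y_{x_1}, …, Y_{x_g})` with `Y` in the lift. -/
def liftProj {g ℓ : ℕ} (p : MatPoly g ℓ ℓ) : FreeFamily g := fun n =>
  {X | ∃ Y ∈ lift p n, ∀ j, X j = Y (FreeMonoid.of j)}

/-! ### The truncated lifts -/

/-- The smallest integer not less than `deg p / 2`. -/
def halfDeg {g ℓ : ℕ} (p : MatPoly g ℓ ℓ) : ℕ := (degree p + 1) / 2

/-- The length up to which the truncated moment sequences of order `d` are defined. -/
def momLen {g ℓ : ℕ} (p : MatPoly g ℓ ℓ) (d : ℕ) : ℕ := 2 * d + degree p + 1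

/-- The truncated word `w^*`. -/
def TruncWord.rev {g N : ℕ} (w : TruncWord g N) : TruncWord g N :=
  ⟨star w.1, by rw [length_star]; exact w.2⟩

/-- The empty word as a truncated word. -/
def TruncWord.empty (g N : ℕ) : TruncWord g N := ⟨1, Nat.zero_le N⟩

/-- The letter `x_j` as a truncated word. -/
def momLetter {g ℓ : ℕ} (p : MatPoly g ℓ ℓ) (d : ℕ) (j : Fin g) : TruncWord g (momLen p d) :=
  ⟨FreeMonoid.of j, by rw [FreeMonoid.length_of]; unfold momLen; omega⟩

/-- The truncated Hankel matrix `(Y_{α^* β})` with `|α|, |β| ≤ d + ⌈deg p / 2⌉`. -/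
def truncHankel {g ℓ n : ℕ} (p : MatPoly g ℓ ℓ) (d : ℕ)
    (Y : TruncWord g (momLen p d) → Matrix (Fin n) (Fin n) ℂ) :
    Matrix (TruncWord g (d + halfDeg p) × Fin n) (TruncWord g (d + halfDeg p) × Fin n) ℂ :=
  Matrix.of fun r c =>
    Y ⟨star r.1.1 * c.1.1, by
      have h1 := r.1.2
      have h2 := c.1.2
      rw [FreeMonoid.length_mul, length_star]
      unfold momLen halfDeg at *
      omega⟩ r.2 c.2

/-- The truncated localizing matrix, with `(α, β)` block `∑ γ, p_γ ⊗ Y_{α^* γ β}` for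
`|α|, |β| ≤ d`. -/
def truncLocalizing {g ℓ n : ℕ} (p : MatPoly g ℓ ℓ) (d : ℕ)
    (Y : TruncWord g (momLen p d) → Matrix (Fin n) (Fin n) ℂ) :
    Matrix (TruncWord g d × (Fin ℓ × Fin n)) (TruncWord g d × (Fin ℓ × Fin n)) ℂ :=
  Matrix.of fun r c =>
    (∑ γ : TruncWord g (degree p), wcoeff p γ.1 ⊗ₖ
      Y ⟨star r.1.1 * γ.1 * c.1.1, by
        have h1 := r.1.2
        have h2 := c.1.2
        have h3 := γ.2
        rw [FreeMonoid.length_mul, FreeMonoid.length_mul, length_star]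
        unfold momLen
        omega⟩) r.2 c.2

/-- The truncated lift `L_p(n; d)`. -/
def truncLift {g ℓ : ℕ} (p : MatPoly g ℓ ℓ) (d n : ℕ) :
    Set (TruncWord g (momLen p d) → Matrix (Fin n) (Fin n) ℂ) :=
  {Y | Y (TruncWord.empty g _) = 1 ∧ (∀ α, Y α.rev = (Y α)ᴴ) ∧
    (truncHankel p d Y).PosSemidef ∧ (truncLocalizing p d Y).PosSemidef}

/-- The projection of the truncated lifts `L_p(·; d)` onto the letters. -/
def truncLiftProj {g ℓ : ℕ} (p : MatPoly g ℓ ℓ) (d : ℕ) : FreeFamily g := fun n =>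
  {X | ∃ Y ∈ truncLift p d n, ∀ j, X j = Y (momLetter p d j)}

/-! ### Linear pencils and free spectrahedrops -/

/-- A linear pencil `A_0 + ∑ A_i x_i` in variables indexed by `ι`, with self-adjoint coefficients
whose rows and columns are indexed by `κ`. -/
structure LinearPencil (ι κ : Type) where
  const : Matrix κ κ ℂ
  coef : ι → Matrix κ κ ℂ
  const_herm : const.IsHermitian
  coef_herm : ∀ i, (coef i).IsHermitian

/-- The evaluation `L(X) = A_0 ⊗ I + ∑ A_i ⊗ X_i`. -/
def LinearPencil.eval {ι κ : Type} [Fintype ι] (L : LinearPencil ι κ) {n : ℕ}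
    (X : ι → Matrix (Fin n) (Fin n) ℂ) : Matrix (κ × Fin n) (κ × Fin n) ℂ :=
  L.const ⊗ₖ (1 : Matrix (Fin n) (Fin n) ℂ) + ∑ i, L.coef i ⊗ₖ X i

/-- The free spectrahedron `D_L` at level `n`. -/
def LinearPencil.spectrahedron {ι κ : Type} [Fintype ι] (L : LinearPencil ι κ) (n : ℕ) :
    Set (ι → Matrix (Fin n) (Fin n) ℂ) :=
  {X | (∀ i, (X i).IsHermitian) ∧ (L.eval X).PosSemidef}

/-- The projection of `D_L` onto the first `g` variables. -/
def LinearPencil.projX {g : ℕ} {η κ : Type} [Fintype η] (L : LinearPencil (Fin g ⊕ η) κ) :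
    FreeFamily g := fun n =>
  {X | ∃ W : η → Matrix (Fin n) (Fin n) ℂ, Sum.elim X W ∈ L.spectrahedron n}

/-- A free spectrahedrop: a coordinate projection of a free spectrahedron, given by one pencil of
finite size in finitely many variables for all matrix sizes `n`. -/
def IsFreeSpectrahedrop {g : ℕ} (Γ : FreeFamily g) : Prop :=
  ∃ (η κ : Type) (_ : Fintype η) (_ : Fintype κ) (L : LinearPencil (Fin g ⊕ η) κ), Γ = L.projX

/-! ### The pencils of the truncated lifts -/

/-- The row index of the pencil of order `d`: one block for the Hankel matrix and one for the
localizing matrix. -/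
abbrev PencilIndex {g ℓ : ℕ} (p : MatPoly g ℓ ℓ) (d : ℕ) : Type :=
  TruncWord g (d + halfDeg p) ⊕ (TruncWord g d × Fin ℓ)

/-- The words of length at least two among those that index truncated moment sequences. -/
abbrev HighWord {g ℓ : ℕ} (p : MatPoly g ℓ ℓ) (d : ℕ) : Type :=
  {w : TruncWord g (momLen p d) // 2 ≤ w.1.length}

/-- The coefficient `E_σ` of the moment `Y_σ` in the direct sum of the truncated Hankel matrix and
the truncated localizing matrix. -/
def momCoef {g ℓ : ℕ} (p : MatPoly g ℓ ℓ) (d : ℕ) (σ : Word g) :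
    Matrix (PencilIndex p d) (PencilIndex p d) ℂ :=
  Matrix.fromBlocks
    (Matrix.of fun α β => if star α.1 * β.1 = σ then 1 else 0) 0 0
    (Matrix.of fun r c => ∑ γ : TruncWord g (degree p),
      if star r.1.1 * γ.1 * c.1.1 = σ then wcoeff p γ.1 r.2 c.2 else 0)

theorem wcoeff_star {g ℓ : ℕ} {p : MatPoly g ℓ ℓ} (hp : p.IsHermitian) (γ : Word g)
    (i j : Fin ℓ) : star (wcoeff p γ i j) = wcoeff p (star γ) j i := by
  have h := hp.apply j i
  have h2 := congrArg (fun q : FreePoly g => q.coeff (star γ)) h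
  have h3 : (star (p i j)).coeff (star γ) = starRingEnd ℂ ((p i j).coeff (star (star γ))) :=
    freeStar_coeff _ _
  simp only [h3, star_star] at h2
  exact h2

theorem TruncWord.rev_rev {g N : ℕ} (w : TruncWord g N) : w.rev.rev = w :=
  Subtype.ext (star_star w.1)

theorem momCoef_conjTranspose {g ℓ : ℕ} {p : MatPoly g ℓ ℓ} (hp : p.IsHermitian) (d : ℕ)
    (σ : Word g) : (momCoef p d σ)ᴴ = momCoef p d (star σ) := by
  rw [momCoef, momCoef, Matrix.fromBlocks_conjTranspose, Matrix.conjTranspose_zero,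
    Matrix.conjTranspose_zero]
  congr 1
  · ext α β
    have : (star β.1 * α.1 = σ) ↔ (star α.1 * β.1 = star σ) := by
      rw [← star_inj]; simp
    simp only [Matrix.conjTranspose_apply, Matrix.of_apply]
    by_cases h : star β.1 * α.1 = σ
    · rw [if_pos h, if_pos (this.1 h), star_one]
    · rw [if_neg h, if_neg fun h' => h (this.2 h'), star_zero]
  · ext r c
    simp only [Matrix.conjTranspose_apply, Matrix.of_apply, star_sum]
    refine Fintype.sum_equiv ⟨TruncWord.rev, TruncWord.rev, TruncWord.rev_rev, TruncWord.rev_rev⟩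
      _ _ fun γ => ?_
    have : (star c.1.1 * γ.1 * r.1.1 = σ) ↔ (star r.1.1 * star γ.1 * c.1.1 = star σ) := by
      rw [← star_inj]; simp [mul_assoc]
    change star (if star c.1.1 * γ.1 * r.1.1 = σ then wcoeff p γ.1 c.2 r.2 else 0) =
      if star r.1.1 * star γ.1 * c.1.1 = star σ then wcoeff p (star γ.1) r.2 c.2 else 0
    by_cases h : star c.1.1 * γ.1 * r.1.1 = σ
    · rw [if_pos h, if_pos (this.1 h)]
      exact wcoeff_star hp _ _ _
    · rw [if_neg h, if_neg fun h' => h (this.2 h'), star_zero]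

/-- The explicit linear pencil `L_d`.  Its variables are `x_1, …, x_g` and self-adjoint `u_σ, v_σ`
for each word `σ` of length at least two; it arises from the linear matrix polynomial
`E_∅ + ∑ E_{x_j} x_j + ½ ∑ (E_σ y_σ + E_σ^* y_σ^*)` by the substitution `y_σ = u_σ + i v_σ`. -/
def lassPencil {g ℓ : ℕ} (p : MatPoly g ℓ ℓ) (hp : p.IsHermitian) (d : ℕ) :
    LinearPencil (Fin g ⊕ (HighWord p d ⊕ HighWord p d)) (PencilIndex p d) where
  const := momCoef p d 1
  coef := Sum.elim (fun j => momCoef p d (FreeMonoid.of j))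
    (Sum.elim
      (fun σ => (1 / 2 : ℂ) • (momCoef p d σ.1.1 + (momCoef p d σ.1.1)ᴴ))
      (fun σ => (Complex.I / 2) • (momCoef p d σ.1.1 - (momCoef p d σ.1.1)ᴴ)))
  const_herm := by
    rw [Matrix.IsHermitian, momCoef_conjTranspose hp, star_one]
  coef_herm := by
    rintro (j | σ | σ)
    · show (momCoef p d (FreeMonoid.of j))ᴴ = _
      rw [momCoef_conjTranspose hp]
      rfl
    · show (_)ᴴ = _
      simp [add_comm]
    · show (_)ᴴ = _
      simp only [Sum.elim_inr, Matrix.conjTranspose_smul, Matrix.conjTranspose_sub,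
        Matrix.conjTranspose_conjTranspose]
      rw [show star (Complex.I / 2) = -(Complex.I / 2) by simp [neg_div], neg_smul, ← smul_neg,
        neg_sub]

end FreeHull

end

noncomputable section

namespace FreeHull

/-! A sequence `Y` in the lift defines a sesquilinear form `momForm Y` on columns of free
polynomials. Its positivity is that of the Hankel matrix (`momForm_nonneg`), and the localizing
matrix gives positivity weighted by `p` (`sum_momForm_nonneg`). The archimedean identity expresses
`K²` as the sum of the squared letters plus terms that are nonnegative for the form, so
multiplication by a letter is bounded (`exists_letter_bound`).

The equality of hull and lift is then a Gelfand–Naimark–Segal argument. Completing the form gives a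
separable Hilbert space, the letters act on it as bounded self-adjoint operators `Z` with `p(Z) ⪰
0`, and the constant columns embed isometrically and compress `Z` to the tuple `(Y_{x_j})`.
Conversely, `Y_w = V^* w(Z) V` is a sequence in the lift: its Hankel matrix is a Gram matrix and its
localizing matrix is a compression of `p(Z)`.

For the intersection of the truncations, the letter bound uses only finite sections, so each moment
is bounded independently of `d` once `d` is large (`exists_moment_bound`). A limit along an
ultrafilter of truncated sequences over the same `X` lies in the full lift.

The pencil is the direct sum of the two truncated matrices, read as linear in the moments. Splitting
each moment into self-adjoint parts accounts for the variables `u` and `v` (`lassPencil_eval`). -/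

/-! ### Hilbert space completion of a semi-inner product -/

/-- The completion of a semi-inner product space, with the extensions to it of a family of
uniformly bounded operators. -/
theorem exists_hilbert_extension {E ι : Type} [AddCommGroup E] [Module ℂ E]
    (c : PreInnerProductSpace.Core ℂ E) (T : ι → E →ₗ[ℂ] E) {K : ℝ} (hK : 0 ≤ K)
    (hb : ∀ j x, (c.inner (T j x) (T j x)).re ≤ K ^ 2 * (c.inner x x).re)
    {S : Set E} (hS : S.Countable) (hspan : Submodule.span ℂ S = ⊤) :
    ∃ (H : Type) (_ : NormedAddCommGroup H) (_ : InnerProductSpace ℂ H) (_ : CompleteSpace H)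
      (_ : TopologicalSpace.SeparableSpace H) (φ : E →ₗ[ℂ] H) (Z : ι → H →L[ℂ] H),
      DenseRange φ ∧ (∀ x y, ⟪φ x, φ y⟫_ℂ = c.inner x y) ∧ ∀ j x, Z j (φ x) = φ (T j x) := by
  -- Only a seminorm is available. The completion is separated, so null vectors vanish there and no
  -- quotient has to be formed first.
  let _ : SeminormedAddCommGroup E := InnerProductSpace.Core.toSeminormedAddCommGroup (c := c)
  let _ : InnerProductSpace ℂ E := InnerProductSpace.ofCore c
  have hbound : ∀ j x, ‖T j x‖ ≤ K * ‖x‖ := by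
    intro j x
    rw [← sq_le_sq₀ (norm_nonneg _) (by positivity), mul_pow, ← inner_self_eq_norm_sq (𝕜 := ℂ),
      ← inner_self_eq_norm_sq (𝕜 := ℂ)]
    exact hb j x
  let φ : E →L[ℂ] UniformSpace.Completion E := UniformSpace.Completion.toComplL
  have hd : DenseRange φ := UniformSpace.Completion.denseRange_coe
  have hsep : TopologicalSpace.SeparableSpace (UniformSpace.Completion E) := by
    rw [← TopologicalSpace.isSeparable_univ_iff]
    have h1 := ((hS.image φ).isSeparable.span (R := ℂ)).closure
    refine h1.mono fun x _ => ?_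
    have h2 : (Submodule.span ℂ (φ '' S) : Set (UniformSpace.Completion E)) = Set.range φ := by
      rw [show φ '' S = (φ : E →ₗ[ℂ] _) '' S from rfl, Submodule.span_image, hspan,
        Submodule.map_top]
      rfl
    rw [h2]
    exact hd x
  refine ⟨UniformSpace.Completion E, inferInstance, inferInstance, inferInstance, hsep,
    φ, fun j => ((T j).mkContinuous K (hbound j)).completion, hd, fun x y => ?_, fun j x => ?_⟩
  · exact UniformSpace.Completion.inner_coe x y
  · exact ContinuousLinearMap.completion_apply_coe _ _

/-! ### The sesquilinear form of a moment sequence -/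

variable {g ℓ n : ℕ}

/-- The value at `q` of the linear functional that maps each word `w` to `(Y_w)_{ij}`. -/
def momFun (Y : Word g → Matrix (Fin n) (Fin n) ℂ) (i j : Fin n) : FreePoly g →ₗ[ℂ] ℂ where
  toFun q := q.coeff.sum fun w c => c * Y w i j
  map_add' a b := by
    rw [MonoidAlgebra.coeff_add]
    exact Finsupp.sum_add_index' (by simp) (fun _ _ _ => add_mul _ _ _)
  map_smul' r a := by
    rw [MonoidAlgebra.coeff_smul, Finsupp.sum_smul_index (by simp)]
    simp [Finsupp.mul_sum, mul_assoc]

theorem momFun_single (Y : Word g → Matrix (Fin n) (Fin n) ℂ) (i j : Fin n) (w : Word g) (c : ℂ) :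
    momFun Y i j (MonoidAlgebra.single w c) = c * Y w i j := by
  simp [momFun]

theorem star_single (w : Word g) (c : ℂ) :
    star (MonoidAlgebra.single w c : FreePoly g) = MonoidAlgebra.single (star w) (star c) :=
  freeStar_single w c

theorem star_smul_freePoly (r : ℂ) (a : FreePoly g) : star (r • a) = star r • star a := by
  induction a using MonoidAlgebra.induction_linear with
  | zero => simp
  | add a b ha hb => simp only [smul_add, star_add, ha, hb]
  | single w c => simp [star_single, MonoidAlgebra.smul_single]

theorem momFun_star {Y : Word g → Matrix (Fin n) (Fin n) ℂ} (hY : ∀ α, Y (star α) = (Y α)ᴴ)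
    (i j : Fin n) (q : FreePoly g) : momFun Y i j (star q) = star (momFun Y j i q) := by
  induction q using MonoidAlgebra.induction_linear with
  | zero => simp
  | add a b ha hb => simp only [star_add, map_add, ha, hb]
  | single w c => simp [star_single, momFun_single, hY]

/-- The sesquilinear form on columns of free polynomials that is defined by a moment sequence. -/
def momForm (Y : Word g → Matrix (Fin n) (Fin n) ℂ) (u v : Fin n → FreePoly g) : ℂ :=
  ∑ i, ∑ j, momFun Y i j (star (u i) * v j)

section
variable (Y : Word g → Matrix (Fin n) (Fin n) ℂ) (u u' v v' : Fin n → FreePoly g)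

theorem momForm_add_left : momForm Y (u + u') v = momForm Y u v + momForm Y u' v := by
  simp [momForm, add_mul, Finset.sum_add_distrib]

theorem momForm_add_right : momForm Y u (v + v') = momForm Y u v + momForm Y u v' := by
  simp [momForm, mul_add, Finset.sum_add_distrib]

theorem momForm_smul_left (r : ℂ) : momForm Y (r • u) v = star r * momForm Y u v := by
  simp [momForm, star_smul_freePoly, Finset.mul_sum]

theorem momForm_smul_right (r : ℂ) : momForm Y u (r • v) = r * momForm Y u v := by
  simp [momForm, Finset.mul_sum]

/-- The form depends on its arguments only through the products `star (u i) * v j`, so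
multiplications by `q` and `star q` are formal adjoints. For letters this becomes the
self-adjointness of the operators `Z j`. -/
theorem momForm_mul_right (q : FreePoly g) : momForm Y (star q • u) v = momForm Y u (q • v) := by
  simp [momForm, mul_assoc]

theorem momForm_zero_right : momForm Y u 0 = 0 := by
  simp [momForm]

theorem momForm_sum_right {κ : Type*} (s : Finset κ) (f : κ → Fin n → FreePoly g) :
    momForm Y u (∑ k ∈ s, f k) = ∑ k ∈ s, momForm Y u (f k) := by
  classical
  induction s using Finset.induction_on with
  | empty => simp [momForm_zero_right]
  | insert a s ha ih => rw [Finset.sum_insert ha, Finset.sum_insert ha, momForm_add_right, ih]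

theorem momForm_sum_smul_right {κ : Type*} (s : Finset κ) (f : κ → FreePoly g) :
    momForm Y u ((∑ k ∈ s, f k) • v) = ∑ k ∈ s, momForm Y u (f k • v) := by
  rw [Finset.sum_smul, momForm_sum_right]

end

theorem momForm_conj {Y : Word g → Matrix (Fin n) (Fin n) ℂ} (hY : ∀ α, Y (star α) = (Y α)ᴴ)
    (u v : Fin n → FreePoly g) : star (momForm Y v u) = momForm Y u v := by
  simp only [momForm, star_sum, ← momFun_star hY, star_mul, star_star]
  exact Finset.sum_comm

/-! ### Free polynomials of bounded length -/

/-- The free polynomials all of whose words have length at most `N`. -/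
def lengthLE (g N : ℕ) : Submodule ℂ (FreePoly g) where
  carrier := {q | ∀ w, q.coeff w ≠ 0 → w.length ≤ N}
  zero_mem' w h := by simp at h
  add_mem' {a b} ha hb w h := by
    by_cases h1 : a.coeff w = 0
    · exact hb w fun h2 => h (by simp [h1, h2])
    · exact ha w h1
  smul_mem' c a ha w h := ha w fun h1 => h (by simp [h1])

theorem lengthLE_mono {N M : ℕ} (h : N ≤ M) : lengthLE g N ≤ lengthLE g M :=
  fun _ hq w hw => (hq w hw).trans h

theorem single_mem_lengthLE {N : ℕ} {w : Word g} (hw : w.length ≤ N) (c : ℂ) :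
    MonoidAlgebra.single w c ∈ lengthLE g N := by
  intro v hv
  rw [MonoidAlgebra.coeff_single] at hv
  rw [← (Finsupp.single_apply_ne_zero.1 hv).1] at hw
  exact hw

theorem exists_mem_lengthLE (q : FreePoly g) : ∃ N, q ∈ lengthLE g N :=
  ⟨q.coeff.support.sup FreeMonoid.length, fun _ hw =>
    Finset.le_sup (f := FreeMonoid.length) (Finsupp.mem_support_iff.2 hw)⟩

/-- A common bound for the lengths of the words in finitely many free polynomials. -/
theorem exists_forall_mem_lengthLE {κ : Type*} [Finite κ] (q : κ → FreePoly g) :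
    ∃ N, ∀ k, q k ∈ lengthLE g N := by
  cases nonempty_fintype κ
  choose N hN using fun k => exists_mem_lengthLE (q k)
  exact ⟨Finset.univ.sup N, fun k => lengthLE_mono (Finset.le_sup (Finset.mem_univ k)) (hN k)⟩

theorem eq_sum_truncWord {N : ℕ} {q : FreePoly g} (hq : q ∈ lengthLE g N) :
    q = ∑ w : TruncWord g N, MonoidAlgebra.single w.1 (q.coeff w.1) := by
  classical
  apply MonoidAlgebra.ext
  ext v
  rw [MonoidAlgebra.coeff_sum, Finsupp.finsetSum_apply]
  simp only [MonoidAlgebra.coeff_single]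
  by_cases hv : v.length ≤ N
  · rw [Finset.sum_eq_single ⟨v, hv⟩]
    · simp
    · intro w _ hw
      exact Finsupp.single_eq_of_ne fun h => hw (Subtype.ext h.symm)
    · simp
  · rw [Finset.sum_eq_zero]
    · by_contra h
      exact hv (hq v h)
    · intro w _
      refine Finsupp.single_eq_of_ne fun h => hv (h ▸ w.2)

theorem mul_mem_lengthLE {N M : ℕ} {a b : FreePoly g} (ha : a ∈ lengthLE g N)
    (hb : b ∈ lengthLE g M) : a * b ∈ lengthLE g (N + M) := by
  rw [eq_sum_truncWord ha, eq_sum_truncWord hb, Finset.sum_mul_sum]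
  refine Submodule.sum_mem _ fun w _ => Submodule.sum_mem _ fun v _ => ?_
  rw [MonoidAlgebra.single_mul_single]
  refine single_mem_lengthLE ?_ _
  rw [FreeMonoid.length_mul]
  exact add_le_add w.2 v.2

theorem mem_lengthLE_degree (p : MatPoly g ℓ ℓ) (a b : Fin ℓ) :
    p a b ∈ lengthLE g (degree p) := by
  intro w hw
  calc w.length ≤ (p a b).coeff.support.sup FreeMonoid.length :=
        Finset.le_sup (f := FreeMonoid.length) (Finsupp.mem_support_iff.2 hw)
    _ ≤ Finset.univ.sup fun b => (p a b).coeff.support.sup FreeMonoid.length :=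
        Finset.le_sup (f := fun b => (p a b).coeff.support.sup FreeMonoid.length)
          (Finset.mem_univ b)
    _ ≤ degree p := Finset.le_sup (f := fun a => Finset.univ.sup fun b =>
          (p a b).coeff.support.sup FreeMonoid.length) (Finset.mem_univ a)

/-! ### Positivity of the form from finite sections -/

/-- The finite section of the Hankel matrix on the words of length at most `N`. -/
def hankelSection (N : ℕ) (Y : Word g → Matrix (Fin n) (Fin n) ℂ) :
    Matrix (TruncWord g N × Fin n) (TruncWord g N × Fin n) ℂ :=
  (hankel Y).submatrix (Prod.map Subtype.val id) (Prod.map Subtype.val id)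

/-- The finite section of the localizing matrix on the words of length at most `N`. -/
def localizingSection (p : MatPoly g ℓ ℓ) (N : ℕ) (Y : Word g → Matrix (Fin n) (Fin n) ℂ) :
    Matrix (TruncWord g N × (Fin ℓ × Fin n)) (TruncWord g N × (Fin ℓ × Fin n)) ℂ :=
  (localizing p Y).submatrix (Prod.map Subtype.val id) (Prod.map Subtype.val id)

theorem sum_interchange {A B C D : Type*} [Fintype A] [Fintype B] [Fintype C] [Fintype D]
    (f : A → B → C → D → ℂ) :
    ∑ a, ∑ b, ∑ c, ∑ d, f a b c d = ∑ c, ∑ a, ∑ d, ∑ b, f a b c d := by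
  rw [Finset.sum_comm (s := (Finset.univ : Finset C))]
  refine Finset.sum_congr rfl fun a _ => ?_
  rw [Finset.sum_comm]
  exact Finset.sum_congr rfl fun c _ => Finset.sum_comm

/-- Expanding in words turns `momForm Y u u` into the quadratic form of the Hankel section at the
coefficient vector of `u`. -/
theorem momForm_nonneg {N : ℕ} {Y : Word g → Matrix (Fin n) (Fin n) ℂ}
    (hY : (hankelSection N Y).PosSemidef) {u : Fin n → FreePoly g}
    (hu : ∀ i, u i ∈ lengthLE g N) : 0 ≤ momForm Y u u := by
  have h := hY.dotProduct_mulVec_nonneg fun k => (u k.2).coeff k.1.1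
  have key : ∀ i j, momFun Y i j (star (u i) * u j) = ∑ α : TruncWord g N, ∑ β : TruncWord g N,
      star ((u i).coeff α.1) * (u j).coeff β.1 * Y (star α.1 * β.1) i j := by
    intro i j
    conv_lhs => rw [eq_sum_truncWord (hu i), eq_sum_truncWord (hu j)]
    simp only [star_sum, star_single, Finset.sum_mul_sum, map_sum,
      MonoidAlgebra.single_mul_single, momFun_single]
  convert h using 1
  simp only [momForm, key, dotProduct, Matrix.mulVec, Fintype.sum_prod_type, Finset.mul_sum]
  rw [sum_interchange]
  refine Finset.sum_congr rfl fun α _ => Finset.sum_congr rfl fun i _ =>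
    Finset.sum_congr rfl fun β _ => Finset.sum_congr rfl fun j _ => ?_
  simp only [hankelSection, hankel, Matrix.submatrix_apply, Matrix.of_apply, Prod.map, id,
    Pi.star_apply]
  ring

/-- Expanding `p` as well as `v` in words gives the quadratic form of the localizing section at the
coefficient vector of `v`. -/
theorem sum_momForm_nonneg {p : MatPoly g ℓ ℓ} {N : ℕ}
    {Y : Word g → Matrix (Fin n) (Fin n) ℂ} (hY : (localizingSection p N Y).PosSemidef)
    {v : Fin ℓ → Fin n → FreePoly g} (hv : ∀ a i, v a i ∈ lengthLE g N) :
    0 ≤ ∑ a, ∑ b, momForm Y (v a) (p a b • v b) := by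
  have h := hY.dotProduct_mulVec_nonneg fun k => (v k.2.1 k.2.2).coeff k.1.1
  have key : ∀ a i b j, momFun Y i j (star (v a i) * (p a b * v b j)) =
      ∑ α : TruncWord g N, ∑ β : TruncWord g N, ∑ γ : TruncWord g (degree p),
      star ((v a i).coeff α.1) * ((p a b).coeff γ.1 * (v b j).coeff β.1) *
        Y (star α.1 * γ.1 * β.1) i j := by
    intro a i b j
    conv_lhs => rw [eq_sum_truncWord (hv a i), eq_sum_truncWord (hv b j),
      eq_sum_truncWord (mem_lengthLE_degree p a b)]
    simp only [star_sum, star_single, Finset.sum_mul_sum, map_sum,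
      MonoidAlgebra.single_mul_single]
    simp only [Finset.mul_sum, MonoidAlgebra.single_mul_single, map_sum, momFun_single, mul_assoc]
    refine Finset.sum_congr rfl fun α _ => ?_
    rw [Finset.sum_comm]
  convert h using 1
  simp only [momForm, Pi.smul_apply, smul_eq_mul, key, dotProduct, Matrix.mulVec,
    Fintype.sum_prod_type, Finset.mul_sum]
  have reorder : ∀ f : Fin ℓ → Fin ℓ → Fin n → Fin n → TruncWord g N → TruncWord g N → ℂ,
      ∑ a, ∑ b, ∑ i, ∑ j, ∑ α, ∑ β, f a b i j α β =
        ∑ α, ∑ a, ∑ i, ∑ β, ∑ b, ∑ j, f a b i j α β := by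
    intro f
    have h1 := sum_interchange fun (k k' : Fin ℓ × Fin n) (α β : TruncWord g N) =>
      f k.1 k'.1 k.2 k'.2 α β
    simp only [Fintype.sum_prod_type] at h1
    rw [← h1]
    exact Finset.sum_congr rfl fun a _ => Finset.sum_comm
  rw [reorder]
  refine Finset.sum_congr rfl fun α _ => Finset.sum_congr rfl fun a _ =>
    Finset.sum_congr rfl fun i _ => Finset.sum_congr rfl fun β _ =>
    Finset.sum_congr rfl fun b _ => Finset.sum_congr rfl fun j _ => ?_
  simp only [localizingSection, localizing, Matrix.submatrix_apply, Matrix.of_apply, Prod.map, id,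
    Pi.star_apply, Matrix.sum_apply, Matrix.kroneckerMap_apply, wcoeff, Finset.sum_mul,
    Finset.mul_sum]
  exact Finset.sum_congr rfl fun γ _ => by ring

/-! ### Boundedness of the letters -/

/-- The archimedean identity, written in the free algebra. -/
theorem archimedean_identity {p : MatPoly g ℓ ℓ} {K : ℝ} {a b t : ℕ} {s : Fin a → MatPoly g t 1}
    {f : Fin b → MatPoly g ℓ 1}
    (h : Matrix.scalar (Fin 1) (((K : ℂ) ^ 2) • (1 : FreePoly g) - ∑ j, letter j ^ 2) =
      ∑ i, (s i)ᴴ * s i + ∑ i, (f i)ᴴ * p * f i) :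
    ((K : ℂ) ^ 2) • (1 : FreePoly g) = ∑ j, letter j * letter j +
      (∑ i, ∑ k, star (s i k 0) * s i k 0 +
        ∑ i, ∑ k, ∑ m, star (f i k 0) * (p k m * f i m 0)) := by
  have h1 := congrFun (congrFun h 0) 0
  rw [Matrix.scalar_apply, Matrix.diagonal_apply_eq, Matrix.add_apply, sub_eq_iff_eq_add'] at h1
  rw [h1]
  congr 1
  · exact Finset.sum_congr rfl fun j _ => sq _
  congr 1
  · simp only [Matrix.sum_apply, Matrix.mul_apply, Matrix.conjTranspose_apply]
  · simp only [Matrix.sum_apply, Matrix.mul_apply, Matrix.conjTranspose_apply, Finset.sum_mul,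
      mul_assoc]
    exact Finset.sum_congr rfl fun i _ => Finset.sum_comm

theorem star_letter (j : Fin g) : star (letter j) = letter j := by
  simp [letter, star_single]

theorem letter_mem_lengthLE (j : Fin g) : letter j ∈ lengthLE g 1 :=
  single_mem_lengthLE (FreeMonoid.length_of j).le 1

/-- Left multiplication by the letters is bounded with respect to every form that satisfies the
positivity conditions up to a certain length. -/
theorem exists_letter_bound {p : MatPoly g ℓ ℓ} (hp : IsArchimedean p) :
    ∃ K : ℝ, 0 < K ∧ ∃ D : ℕ, ∀ (n N : ℕ) (Y : Word g → Matrix (Fin n) (Fin n) ℂ),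
      (hankelSection (N + D) Y).PosSemidef → (localizingSection p (N + D) Y).PosSemidef →
      ∀ (u : Fin n → FreePoly g), (∀ i, u i ∈ lengthLE g N) → ∀ j : Fin g,
        momForm Y (letter j • u) (letter j • u) ≤ (K : ℂ) ^ 2 * momForm Y u u := by
  obtain ⟨K, hK, a, b, t, s, f, h⟩ := hp
  obtain ⟨D₁, hD₁⟩ := exists_forall_mem_lengthLE fun k : Fin a × Fin t => s k.1 k.2 0
  obtain ⟨D₂, hD₂⟩ := exists_forall_mem_lengthLE fun k : Fin b × Fin ℓ => f k.1 k.2 0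
  -- Multiplying `u` by a letter, an entry of some `s i` or an entry of some `f i` raises lengths by
  -- at most `1`, `D₁` or `D₂`; the sum bounds all three and does not depend on `n` or `N`.
  refine ⟨K, hK, 1 + D₁ + D₂, fun n N Y hH hL u hu j => ?_⟩
  have hmem : ∀ {M : ℕ} {q : FreePoly g}, M ≤ 1 + D₁ + D₂ → q ∈ lengthLE g M → ∀ i,
      (q • u) i ∈ lengthLE g (N + (1 + D₁ + D₂)) := fun hM hq i =>
    lengthLE_mono (by omega) (mul_mem_lengthLE hq (hu i))
  -- The archimedean identity applied to `u`, with each left factor moved to the first argument of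
  -- the form. Every group on the right is nonnegative, so the term of a single letter is at most
  -- the left side.
  have hid : (K : ℂ) ^ 2 * momForm Y u u =
      ∑ j : Fin g, momForm Y (letter j • u) (letter j • u) +
      (∑ i, ∑ k, momForm Y (s i k 0 • u) (s i k 0 • u) +
        ∑ i, ∑ k, ∑ m, momForm Y (f i k 0 • u) (p k m • f i m 0 • u)) := by
    have h1 : ((K : ℂ) ^ 2) • u = (((K : ℂ) ^ 2) • (1 : FreePoly g)) • u := by
      rw [smul_assoc, one_smul]
    rw [← momForm_smul_right, h1, archimedean_identity h, add_smul, add_smul, momForm_add_right,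
      momForm_add_right]
    have hm : ∀ (q : FreePoly g) w, momForm Y (q • u) w = momForm Y u (star q • w) := fun q w => by
      rw [← momForm_mul_right, star_star]
    simp only [momForm_sum_smul_right, mul_smul, hm, star_letter]
  rw [hid]
  have hlet : ∀ j : Fin g, 0 ≤ momForm Y (letter j • u) (letter j • u) := fun j =>
    momForm_nonneg hH (hmem (by omega) (letter_mem_lengthLE j))
  have h1 : momForm Y (letter j • u) (letter j • u) ≤
      ∑ j : Fin g, momForm Y (letter j • u) (letter j • u) :=
    Finset.single_le_sum (f := fun j : Fin g => momForm Y (letter j • u) (letter j • u))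
      (fun j _ => hlet j) (Finset.mem_univ j)
  refine h1.trans (le_add_of_nonneg_right (add_nonneg ?_ ?_))
  · exact Finset.sum_nonneg fun i _ => Finset.sum_nonneg fun k _ =>
      momForm_nonneg hH (hmem (by omega) (hD₁ (i, k)))
  · exact Finset.sum_nonneg fun i _ => sum_momForm_nonneg hL fun k =>
      hmem (by omega) (hD₂ (i, k))

/-! ### From moment sequences to operators -/

theorem hankelSection_posSemidef {Y : Word g → Matrix (Fin n) (Fin n) ℂ}
    (h : (hankel Y).PosSemidef) (N : ℕ) : (hankelSection N Y).PosSemidef :=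
  h.submatrix _

theorem localizingSection_posSemidef {p : MatPoly g ℓ ℓ} {Y : Word g → Matrix (Fin n) (Fin n) ℂ}
    (h : (localizing p Y).PosSemidef) (N : ℕ) : (localizingSection p N Y).PosSemidef :=
  h.submatrix _

/-- The semi-inner product of a moment sequence with a positive semidefinite Hankel matrix. -/
@[reducible] def momCore {Y : Word g → Matrix (Fin n) (Fin n) ℂ} (hY : ∀ α, Y (star α) = (Y α)ᴴ)
    (hH : (hankel Y).PosSemidef) : PreInnerProductSpace.Core ℂ (Fin n → FreePoly g) where
  inner := momForm Y
  conj_inner_symm u v := momForm_conj hY u v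
  re_inner_nonneg u := by
    obtain ⟨N, hN⟩ := exists_forall_mem_lengthLE u
    exact (Complex.le_def.1 (momForm_nonneg (hankelSection_posSemidef hH N) hN)).1
  add_left u v w := momForm_add_left Y u v w
  smul_left u v r := momForm_smul_left Y u v r

theorem exists_countable_span (g n : ℕ) :
    ∃ S : Set (Fin n → FreePoly g), S.Countable ∧ Submodule.span ℂ S = ⊤ := by
  have : Countable (Word g) := inferInstanceAs (Countable (List (Fin g)))
  refine ⟨Set.range fun k : Word g × Fin n => Pi.single k.2 (MonoidAlgebra.single k.1 1),
    Set.countable_range _, ?_⟩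
  rw [eq_top_iff]
  intro u _
  rw [← Finset.univ_sum_single u]
  refine Submodule.sum_mem _ fun i _ => ?_
  obtain ⟨N, hN⟩ := exists_mem_lengthLE (u i)
  rw [eq_sum_truncWord hN]
  have h : (Pi.single i (∑ w : TruncWord g N, MonoidAlgebra.single w.1 ((u i).coeff w.1)) :
      Fin n → FreePoly g) = ∑ w : TruncWord g N, (u i).coeff w.1 •
        (Pi.single i (MonoidAlgebra.single w.1 1) : Fin n → FreePoly g) := by
    ext1 k
    by_cases hk : k = i
    · subst hk
      simp [MonoidAlgebra.smul_single]
    · simp [hk]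
  rw [h]
  exact Submodule.sum_mem _ fun w _ =>
    Submodule.smul_mem _ _ (Submodule.subset_span ⟨(w.1, i), rfl⟩)

theorem evalOper_single {H : Type} [NormedAddCommGroup H] [InnerProductSpace ℂ H]
    (Z : Fin g → H →L[ℂ] H) (w : Word g) (c : ℂ) :
    evalOper Z (MonoidAlgebra.single w c) = c • FreeMonoid.lift Z w :=
  MonoidAlgebra.lift_single _ _ _

/-- Evaluation is multiplicative, so the action of the letters determines that of every `q`. On the
dense range of `φ`, positivity of `p(Z)` thereby becomes a statement about `momForm`. -/
theorem evalOper_intertwine {H : Type} [NormedAddCommGroup H] [InnerProductSpace ℂ H]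
    {Z : Fin g → H →L[ℂ] H} {φ : (Fin n → FreePoly g) →ₗ[ℂ] H}
    (h : ∀ j u, Z j (φ u) = φ (letter j • u)) (q : FreePoly g) (u : Fin n → FreePoly g) :
    evalOper Z q (φ u) = φ (q • u) := by
  induction q using MonoidAlgebra.induction_linear with
  | zero => simp [evalOper]
  | add a b ha hb =>
    rw [add_smul, map_add, ← ha, ← hb]
    simp [evalOper]
  | single w c =>
    have hw : ∀ w : Word g, FreeMonoid.lift Z w (φ u) =
        φ ((MonoidAlgebra.single w (1 : ℂ) : FreePoly g) • u) := by
      intro w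
      induction w using FreeMonoid.inductionOn' with
      | one => simp [← MonoidAlgebra.one_def]
      | of_mul j w ih =>
        rw [map_mul, mul_apply_eq_comp, ih, FreeMonoid.lift_eval_of, h, ← mul_smul,
          letter, MonoidAlgebra.of_apply, MonoidAlgebra.single_mul_single, one_mul]
    rw [evalOper_single, smul_apply, hw, ← map_smul, ← smul_assoc,
      MonoidAlgebra.smul_single, smul_eq_mul, mul_one]

/-- The columns of constants. -/
def constCol (g n : ℕ) : EuclideanSpace ℂ (Fin n) →ₗ[ℂ] (Fin n → FreePoly g) where
  toFun x i := MonoidAlgebra.single 1 (x i)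
  map_add' x y := by
    ext1 i
    simp [MonoidAlgebra.single_add]
  map_smul' c x := by
    ext1 i
    simp [MonoidAlgebra.smul_single]

theorem constCol_apply (x : EuclideanSpace ℂ (Fin n)) (i : Fin n) :
    constCol g n x i = MonoidAlgebra.single 1 (x i) := rfl

theorem inner_toEuclideanCLM (A : Matrix (Fin n) (Fin n) ℂ) (x y : EuclideanSpace ℂ (Fin n)) :
    ⟪x, Matrix.toEuclideanCLM (𝕜 := ℂ) A y⟫_ℂ = ∑ i, ∑ j, star (x i) * y j * A i j := by
  simp only [PiLp.inner_apply, Matrix.ofLp_toEuclideanCLM, Matrix.mulVec, dotProduct, RCLike.inner_apply,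
    Finset.sum_mul]
  refine Finset.sum_congr rfl fun i _ => Finset.sum_congr rfl fun j _ => ?_
  rw [starRingEnd_apply]
  ring

/-- Identifies `Y w` with the compression of multiplication by `w` to the constant columns. The
empty word yields the isometry, the letters yield `X`. -/
theorem momForm_constCol (Y : Word g → Matrix (Fin n) (Fin n) ℂ) (w : Word g)
    (x y : EuclideanSpace ℂ (Fin n)) :
    momForm Y (constCol g n x) ((MonoidAlgebra.single w (1 : ℂ) : FreePoly g) • constCol g n y) =
      ⟪x, Matrix.toEuclideanCLM (𝕜 := ℂ) (Y w) y⟫_ℂ := by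
  rw [inner_toEuclideanCLM]
  simp [momForm, constCol_apply, star_single, MonoidAlgebra.single_mul_single, momFun_single]

theorem liftProj_subset_coOper {p : MatPoly g ℓ ℓ} (hp : IsArchimedean p) :
    liftProj p n ⊆ coOper p n := by
  rintro X ⟨Y, ⟨hY1, hYs, hH, hL⟩, hX⟩
  obtain ⟨K, hK, D, hD⟩ := exists_letter_bound hp
  obtain ⟨S, hSc, hS⟩ := exists_countable_span g n
  obtain ⟨H, i₁, i₂, i₃, i₄, φ, Z, hd, hφ, hZ⟩ := exists_hilbert_extension (momCore hYs hH)
    (fun j : Fin g => Algebra.lsmul ℂ ℂ (Fin n → FreePoly g) (letter j)) hK.le (by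
      intro j u
      obtain ⟨N, hN⟩ := exists_forall_mem_lengthLE u
      have h := hD n N Y (hankelSection_posSemidef hH _) (localizingSection_posSemidef hL _) u hN j
      have h2 := (Complex.le_def.1 h).1
      rw [← Complex.ofReal_pow, Complex.re_ofReal_mul] at h2
      exact h2) hSc hS
  replace hφ : ∀ u v, ⟪φ u, φ v⟫_ℂ = momForm Y u v := hφ
  replace hZ : ∀ j u, Z j (φ u) = φ (letter j • u) := hZ
  have hev := evalOper_intertwine hZ
  have hVinner : ∀ x y, ⟪(φ ∘ₗ constCol g n) x, (φ ∘ₗ constCol g n) y⟫_ℂ = ⟪x, y⟫_ℂ := by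
    intro x y
    have h := momForm_constCol Y 1 x y
    rw [← MonoidAlgebra.one_def, one_smul, hY1, map_one] at h
    rw [LinearMap.comp_apply, LinearMap.comp_apply, hφ, h]
    rfl
  refine ⟨fun j => ?_, H, i₁, i₂, i₃, i₄, Z, ⟨fun j => ?_, ?_⟩,
    (φ ∘ₗ constCol g n).isometryOfInner hVinner, fun j => ?_⟩
  · rw [hX, Matrix.IsHermitian, ← hYs, FreeMonoid.star_of]
  · rw [ContinuousLinearMap.isSelfAdjoint_iff_isSymmetric]
    intro x y
    refine hd.induction_on₂ (p := fun x y => ⟪Z j x, y⟫_ℂ = ⟪x, Z j y⟫_ℂ)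
      (isClosed_eq (by fun_prop) (by fun_prop)) (fun u v => ?_) x y
    rw [hZ, hZ, hφ, hφ, ← momForm_mul_right, star_letter]
  · intro v
    -- The condition is closed in `v`, so it suffices to check it on tuples from the dense range of
    -- `φ`.
    have hd' : DenseRange (Pi.map fun _ : Fin ℓ => φ) := DenseRange.piMap fun _ => hd
    refine hd'.induction_on
      (p := fun v => 0 ≤ ∑ a, ∑ b, ⟪v a, evalOper Z (p a b) (v b)⟫_ℂ) v
      (isClosed_le continuous_const (by fun_prop)) fun u => ?_
    simp only [Pi.map_apply, hev, hφ]
    obtain ⟨N, hN⟩ := exists_forall_mem_lengthLE fun k : Fin ℓ × Fin n => u k.1 k.2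
    exact sum_momForm_nonneg (localizingSection_posSemidef hL N) fun a i => hN (a, i)
  · ext1 y
    refine ext_inner_left ℂ fun x => ?_
    rw [hX, ← momForm_constCol, ContinuousLinearMap.comp_apply, ContinuousLinearMap.adjoint_inner_right]
    change _ = ⟪φ (constCol g n x), Z j (φ (constCol g n y))⟫_ℂ
    rw [hZ, hφ]
    rfl

/-! ### From operators to moment sequences -/

theorem star_freeMonoid_lift {H : Type} [NormedAddCommGroup H] [InnerProductSpace ℂ H]
    [CompleteSpace H] {Z : Fin g → H →L[ℂ] H} (hZ : ∀ j, IsSelfAdjoint (Z j)) (w : Word g) :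
    ContinuousLinearMap.adjoint (FreeMonoid.lift Z w) = FreeMonoid.lift Z (star w) := by
  rw [← ContinuousLinearMap.star_eq_adjoint]
  induction w using FreeMonoid.inductionOn' with
  | one => simp
  | of_mul j w ih =>
    rw [map_mul, star_mul, star_mul, ih, FreeMonoid.lift_eval_of, (hZ j).star_eq, map_mul,
      FreeMonoid.star_of, FreeMonoid.lift_eval_of]

theorem hankel_isHermitian {Y : Word g → Matrix (Fin n) (Fin n) ℂ}
    (hY : ∀ α, Y (star α) = (Y α)ᴴ) : (hankel Y).IsHermitian := by
  ext r c
  simp only [hankel, Matrix.conjTranspose_apply, Matrix.of_apply]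
  rw [show star r.1 * c.1 = star (star c.1 * r.1) by simp, hY]
  rfl

/-- In this form the Hermitian symmetry of the localizing matrix follows from `momFun_star` and the
symmetry of `p`. -/
theorem localizing_apply (p : MatPoly g ℓ ℓ) (Y : Word g → Matrix (Fin n) (Fin n) ℂ)
    (r c : Word g × (Fin ℓ × Fin n)) :
    localizing p Y r c = momFun Y r.2.2 c.2.2
      (star (MonoidAlgebra.single r.1 (1 : ℂ) : FreePoly g) *
        (p r.2.1 c.2.1 * MonoidAlgebra.single c.1 1)) := by
  conv_rhs => rw [eq_sum_truncWord (mem_lengthLE_degree p r.2.1 c.2.1)]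
  simp only [Finset.sum_mul, Finset.mul_sum, star_single, MonoidAlgebra.single_mul_single,
    map_sum, momFun_single]
  simp [localizing, Matrix.sum_apply, wcoeff, mul_assoc]

theorem localizing_isHermitian {p : MatPoly g ℓ ℓ} (hp : p.IsHermitian)
    {Y : Word g → Matrix (Fin n) (Fin n) ℂ} (hY : ∀ α, Y (star α) = (Y α)ᴴ) :
    (localizing p Y).IsHermitian := by
  ext r c
  rw [Matrix.conjTranspose_apply, localizing_apply, localizing_apply, ← momFun_star hY,
    star_mul, star_mul, star_star, hp.apply, mul_assoc]

/-- The moments are `Y_w = V^* w(Z) V`. As the adjoint of `w(Z)` is `(star w)(Z)`, the Hankel matrix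
is the Gram matrix of the vectors `w(Z) V e_i`, and the localizing matrix is the form of `p(Z)` on
them. -/
theorem coOper_subset_liftProj {p : MatPoly g ℓ ℓ} (hp : p.IsHermitian) : coOper p n ⊆ liftProj p n := by
  rintro X ⟨hXh, H, _, _, _, _, Z, ⟨hZs, hZp⟩, V, hX⟩
  let e : Fin n → H := fun i => V (EuclideanSpace.single i 1)
  let Y : Word g → Matrix (Fin n) (Fin n) ℂ := fun w =>
    Matrix.of fun i j => ⟪e i, FreeMonoid.lift Z w (e j)⟫_ℂ
  have hY : ∀ α β i j, Y (star α * β) i j =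
      ⟪FreeMonoid.lift Z α (e i), FreeMonoid.lift Z β (e j)⟫_ℂ := by
    intro α β i j
    rw [← ContinuousLinearMap.adjoint_inner_right, star_freeMonoid_lift hZs,
      ← mul_apply_eq_comp, ← map_mul]
    rfl
  have hYs : ∀ α, Y (star α) = (Y α)ᴴ := by
    intro α
    ext i j
    have h := hY α 1 i j
    rw [mul_one, map_one] at h
    rw [h, Matrix.conjTranspose_apply]
    exact (inner_conj_symm _ _).symm
  have hloc : ∀ r c : Word g × (Fin ℓ × Fin n), localizing p Y r c =
      ⟪FreeMonoid.lift Z r.1 (e r.2.2),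
        evalOper Z (p r.2.1 c.2.1) (FreeMonoid.lift Z c.1 (e c.2.2))⟫_ℂ := by
    intro r c
    rw [eq_sum_truncWord (mem_lengthLE_degree p r.2.1 c.2.1)]
    have h1 : evalOper Z (∑ w : TruncWord g (degree p), MonoidAlgebra.single w.1
        ((p r.2.1 c.2.1).coeff w.1)) = ∑ w : TruncWord g (degree p),
          (p r.2.1 c.2.1).coeff w.1 • FreeMonoid.lift Z w.1 := by
      simp only [← evalOper_single]
      exact map_sum (MonoidAlgebra.lift ℂ (H →L[ℂ] H) (Word g) (FreeMonoid.lift Z)) _ _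
    have h2 : ∀ w : Word g, ⟪FreeMonoid.lift Z r.1 (e r.2.2),
        FreeMonoid.lift Z w (FreeMonoid.lift Z c.1 (e c.2.2))⟫_ℂ =
          Y (star r.1 * w * c.1) r.2.2 c.2.2 := fun w => by
      rw [← mul_apply_eq_comp, ← map_mul, mul_assoc, hY]
    rw [h1, sum_apply, inner_sum]
    simp only [smul_apply, inner_smul_right, h2]
    simp [localizing, Matrix.sum_apply, wcoeff]
  refine ⟨Y, ⟨?_, hYs, ⟨hankel_isHermitian hYs, fun x => ?_⟩,
    ⟨localizing_isHermitian hp hYs, fun x => ?_⟩⟩, fun j => ?_⟩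
  · ext i j
    simp only [Y, e, Matrix.of_apply, map_one, one_apply_eq_self,
      LinearIsometry.inner_map_map]
    simp [Matrix.one_apply, EuclideanSpace.inner_single_left]
  · have h : (x.sum fun r xr => x.sum fun c xc => star xr * hankel Y r c * xc) =
        ⟪x.sum fun r xr => xr • FreeMonoid.lift Z r.1 (e r.2),
          x.sum fun r xr => xr • FreeMonoid.lift Z r.1 (e r.2)⟫_ℂ := by
      simp only [Finsupp.sum, sum_inner]
      simp only [inner_sum]
      simp only [inner_smul_left, inner_smul_right, ← hY]
      refine Finset.sum_congr rfl fun r _ => Finset.sum_congr rfl fun c _ => ?_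
      rw [starRingEnd_apply, hankel, Matrix.of_apply]
      ring
    rw [h, inner_self_eq_norm_sq_to_K]
    positivity
  -- The `a`-th component of the test vector collects the terms of `x` whose index in `Fin ℓ` is
  -- `a`; the sums over `a` and `b` then collapse.
  · have h := hZp fun a => ∑ r ∈ x.support,
      if r.2.1 = a then x r • FreeMonoid.lift Z r.1 (e r.2.2) else 0
    convert h using 1
    have h2 : ∀ a b (r c : Word g × (Fin ℓ × Fin n)),
        ⟪if r.2.1 = a then x r • FreeMonoid.lift Z r.1 (e r.2.2) else 0,
          evalOper Z (p a b)
            (if c.2.1 = b then x c • FreeMonoid.lift Z c.1 (e c.2.2) else 0)⟫_ℂ =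
        if r.2.1 = a then (if c.2.1 = b then star (x r) * localizing p Y r c * x c else 0)
          else 0 := by
      intro a b r c
      split_ifs with h1 h2
      · subst h1 h2
        rw [map_smul, inner_smul_left, inner_smul_right, hloc, starRingEnd_apply]
        ring
      · simp
      · simp
      · simp
    have h3 : ∀ f : Fin ℓ → Fin ℓ → Word g × (Fin ℓ × Fin n) → Word g × (Fin ℓ × Fin n) → ℂ,
        ∑ a, ∑ b, ∑ r ∈ x.support, ∑ c ∈ x.support, f a b r c =
          ∑ r ∈ x.support, ∑ c ∈ x.support, ∑ a, ∑ b, f a b r c := fun f => by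
      simp only [← Fintype.sum_prod_type' fun a b => ∑ r ∈ x.support, ∑ c ∈ x.support, f a b r c,
        ← Fintype.sum_prod_type' fun a b => f a b _ _]
      rw [Finset.sum_comm]
      exact Finset.sum_congr rfl fun r _ => Finset.sum_comm
    simp only [map_sum, sum_inner]
    simp only [inner_sum]
    simp only [h2]
    rw [h3]
    refine Finset.sum_congr rfl fun r _ => Finset.sum_congr rfl fun c _ => ?_
    simp
  · ext i k
    have h := congrArg (fun A => ⟪EuclideanSpace.single i (1 : ℂ), A (EuclideanSpace.single k 1)⟫_ℂ)
      (hX j)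
    simp only [ContinuousLinearMap.comp_apply, ContinuousLinearMap.adjoint_inner_right] at h
    rw [inner_toEuclideanCLM] at h
    simpa [Y, e, Pi.single_apply] using h

/-! ### Truncated lifts and their intersection -/

section Limits

open Filter Topology

theorem truncHankel_restrict (p : MatPoly g ℓ ℓ) (d : ℕ) (W : Word g → Matrix (Fin n) (Fin n) ℂ) :
    truncHankel p d (fun α => W α.1) = hankelSection (d + halfDeg p) W := rfl

theorem truncLocalizing_restrict (p : MatPoly g ℓ ℓ) (d : ℕ)
    (W : Word g → Matrix (Fin n) (Fin n) ℂ) :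
    truncLocalizing p d (fun α => W α.1) = localizingSection p d W := rfl

theorem hankelSection_of_le {N M : ℕ} (h : N ≤ M) {W : Word g → Matrix (Fin n) (Fin n) ℂ}
    (hW : (hankelSection M W).PosSemidef) : (hankelSection N W).PosSemidef :=
  hW.submatrix fun k : TruncWord g N × Fin n => (⟨k.1.1, k.1.2.trans h⟩, k.2)

theorem localizingSection_of_le {p : MatPoly g ℓ ℓ} {N M : ℕ} (h : N ≤ M)
    {W : Word g → Matrix (Fin n) (Fin n) ℂ} (hW : (localizingSection p M W).PosSemidef) :
    (localizingSection p N W).PosSemidef :=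
  hW.submatrix fun k : TruncWord g N × (Fin ℓ × Fin n) => (⟨k.1.1, k.1.2.trans h⟩, k.2)

/-- The truncated lifts in terms of moment sequences that are defined on all words. -/
theorem mem_truncLiftProj_iff {p : MatPoly g ℓ ℓ} {d : ℕ} {X : Fin g → Matrix (Fin n) (Fin n) ℂ} :
    X ∈ truncLiftProj p d n ↔ ∃ W : Word g → Matrix (Fin n) (Fin n) ℂ,
      W 1 = 1 ∧ (∀ α, W (star α) = (W α)ᴴ) ∧ (hankelSection (d + halfDeg p) W).PosSemidef ∧
        (localizingSection p d W).PosSemidef ∧ ∀ j, X j = W (FreeMonoid.of j) := by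
  constructor
  · rintro ⟨Y, ⟨h1, hs, hH, hL⟩, hX⟩
    -- Extension by zero is harmless: the two sections involve only words within `momLen p d`, and
    -- reversal preserves length, so the symmetry survives.
    let W : Word g → Matrix (Fin n) (Fin n) ℂ := fun w =>
      if h : w.length ≤ momLen p d then Y ⟨w, h⟩ else 0
    have hW : (fun α : TruncWord g (momLen p d) => W α.1) = Y := by
      funext α
      exact dif_pos α.2
    have hW' : ∀ α : TruncWord g (momLen p d), W α.1 = Y α := congrFun hW
    refine ⟨W, ?_, fun α => ?_, ?_, ?_, fun j => ?_⟩
    · exact (hW' (TruncWord.empty g _)).trans h1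
    · by_cases h : α.length ≤ momLen p d
      · have h2 := hs ⟨α, h⟩
        rw [← hW', ← hW'] at h2
        exact h2
      · have h2 : W α = 0 := dif_neg h
        have h3 : W (star α) = 0 := dif_neg (by rwa [length_star])
        rw [h2, h3, Matrix.conjTranspose_zero]
    · rwa [← truncHankel_restrict, hW]
    · rwa [← truncLocalizing_restrict, hW]
    · rw [hX]
      exact (hW' (momLetter p d j)).symm
  · rintro ⟨W, h1, hs, hH, hL, hX⟩
    exact ⟨fun α => W α.1, ⟨h1, fun α => hs α.1, hH, hL⟩, hX⟩

theorem antitone_truncLiftProj (p : MatPoly g ℓ ℓ) (n : ℕ) :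
    Antitone fun d => truncLiftProj p d n := by
  intro d e hde X hX
  obtain ⟨W, h1, hs, hH, hL, hX⟩ := mem_truncLiftProj_iff.1 hX
  exact mem_truncLiftProj_iff.2 ⟨W, h1, hs, hankelSection_of_le (by omega) hH,
    localizingSection_of_le hde hL, hX⟩

theorem liftProj_subset_truncLiftProj (p : MatPoly g ℓ ℓ) (d n : ℕ) :
    liftProj p n ⊆ truncLiftProj p d n := by
  rintro X ⟨W, ⟨h1, hs, hH, hL⟩, hX⟩
  exact mem_truncLiftProj_iff.2 ⟨W, h1, hs, hankelSection_posSemidef hH _,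
    localizingSection_posSemidef hL _, hX⟩

/-- A crude Cauchy–Schwarz inequality: positivity at `u + c • v` for `c = 1, -1, i, -i` bounds the
real and imaginary parts each by half the right side. -/
theorem norm_momForm_le {N : ℕ} {Y : Word g → Matrix (Fin n) (Fin n) ℂ}
    (hs : ∀ α, Y (star α) = (Y α)ᴴ) (hY : (hankelSection N Y).PosSemidef)
    {u v : Fin n → FreePoly g} (hu : ∀ i, u i ∈ lengthLE g N) (hv : ∀ i, v i ∈ lengthLE g N) :
    ‖momForm Y u v‖ ≤ (momForm Y u u).re + (momForm Y v v).re := by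
  have key : ∀ c : ℂ, star c * c = 1 →
      0 ≤ (momForm Y u u).re + (momForm Y v v).re + 2 * (c * momForm Y u v).re := by
    intro c hc
    have h := momForm_nonneg hY (u := u + c • v) fun i =>
      Submodule.add_mem _ (hu i) (Submodule.smul_mem _ c (hv i))
    have h2 : momForm Y (u + c • v) (u + c • v) = momForm Y u u + momForm Y v v +
        (c * momForm Y u v + star (c * momForm Y u v)) := by
      rw [momForm_add_left, momForm_add_right, momForm_add_right, momForm_smul_left,
        momForm_smul_left, momForm_smul_right, momForm_smul_right, star_mul, momForm_conj hs,
        ← mul_assoc, hc]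
      ring
    rw [h2] at h
    have h3 := (Complex.le_def.1 h).1
    simp only [Complex.add_re, Complex.star_def, Complex.conj_re, Complex.zero_re] at h3
    linarith
  have k1 := key 1 (by simp)
  have k2 := key (-1) (by simp)
  have k3 := key Complex.I (by simp)
  have k4 := key (-Complex.I) (by simp)
  simp only [one_mul, neg_mul, Complex.neg_re, Complex.mul_re, Complex.I_re, Complex.I_im,
    zero_mul, zero_sub] at k1 k2 k3 k4
  refine (Complex.norm_le_abs_re_add_abs_im _).trans ?_
  have h1 : |(momForm Y u v).re| ≤ ((momForm Y u u).re + (momForm Y v v).re) / 2 :=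
    abs_le.2 ⟨by linarith, by linarith⟩
  have h2 : |(momForm Y u v).im| ≤ ((momForm Y u u).re + (momForm Y v v).re) / 2 :=
    abs_le.2 ⟨by linarith, by linarith⟩
  linarith

theorem smul_constCol_mem_lengthLE {N : ℕ} {w : Word g} (hw : w.length ≤ N)
    (x : EuclideanSpace ℂ (Fin n)) (i : Fin n) :
    ((MonoidAlgebra.single w (1 : ℂ) : FreePoly g) • constCol g n x) i ∈ lengthLE g N := by
  rw [Pi.smul_apply, smul_eq_mul, constCol_apply, MonoidAlgebra.single_mul_single, mul_one]
  exact single_mem_lengthLE hw _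

/-- The entries of a truncated moment sequence of an archimedean polynomial are bounded by constants
that depend only on the word. -/
theorem exists_moment_bound {p : MatPoly g ℓ ℓ} (hp : IsArchimedean p) :
    ∃ (D : ℕ) (C : Word g → ℝ), ∀ (n : ℕ) (w : Word g) (Y : Word g → Matrix (Fin n) (Fin n) ℂ),
      Y 1 = 1 → (∀ α, Y (star α) = (Y α)ᴴ) → (hankelSection (w.length + D) Y).PosSemidef →
      (localizingSection p (w.length + D) Y).PosSemidef → ∀ i j, ‖Y w i j‖ ≤ C w := by
  obtain ⟨K, hK, D, hD⟩ := exists_letter_bound hp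
  -- The `1` is the form at a constant unit column, since `Y 1 = 1`; the power comes from applying
  -- the letter bound once per letter of `w`.
  refine ⟨D, fun w => 1 + (K ^ 2) ^ w.length, fun n w Y h1 hs hH hL i j => ?_⟩
  let e : Fin n → Fin n → FreePoly g := fun i => constCol g n (EuclideanSpace.single i 1)
  have hee : ∀ i, momForm Y (e i) (e i) = 1 := by
    intro i
    have h := momForm_constCol Y 1 (EuclideanSpace.single i 1) (EuclideanSpace.single i 1)
    rw [← MonoidAlgebra.one_def, one_smul, h1, inner_toEuclideanCLM] at h
    exact h.trans (by simp)
  have hbd : ∀ v : Word g, v.length ≤ w.length →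
      (momForm Y ((MonoidAlgebra.single v (1 : ℂ) : FreePoly g) • e j)
        ((MonoidAlgebra.single v (1 : ℂ) : FreePoly g) • e j)).re ≤ (K ^ 2) ^ v.length := by
    intro v
    induction v using FreeMonoid.inductionOn' with
    | one =>
      intro _
      rw [← MonoidAlgebra.one_def, one_smul, hee]
      simp
    | of_mul k v ih =>
      intro hv
      rw [FreeMonoid.length_mul, FreeMonoid.length_of] at hv ⊢
      have h := hD n v.length Y (hankelSection_of_le (by omega) hH)
        (localizingSection_of_le (by omega) hL)
        ((MonoidAlgebra.single v (1 : ℂ) : FreePoly g) • e j)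
        (smul_constCol_mem_lengthLE le_rfl _) k
      rw [← mul_smul, letter, MonoidAlgebra.of_apply, MonoidAlgebra.single_mul_single,
        one_mul] at h
      have h2 := (Complex.le_def.1 h).1
      rw [← Complex.ofReal_pow, Complex.re_ofReal_mul] at h2
      refine h2.trans ?_
      rw [pow_add, pow_one]
      exact mul_le_mul_of_nonneg_left (ih (by omega)) (by positivity)
  have h := norm_momForm_le hs hH (u := e i)
    (v := (MonoidAlgebra.single w (1 : ℂ) : FreePoly g) • e j)
    (fun k => single_mem_lengthLE (Nat.zero_le _) _)
    (fun k => smul_constCol_mem_lengthLE (by omega) _ k)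
  rw [momForm_constCol, inner_toEuclideanCLM, hee] at h
  have h3 : ∑ a, ∑ b, star ((EuclideanSpace.single i (1 : ℂ) : EuclideanSpace ℂ (Fin n)) a) *
      (EuclideanSpace.single j (1 : ℂ) : EuclideanSpace ℂ (Fin n)) b * Y w a b = Y w i j := by
    simp
  rw [h3, Complex.one_re] at h
  exact h.trans (by linarith [hbd w le_rfl])

/-- A limit of matrices whose finite principal submatrices are eventually positive semidefinite is
positive semidefinite. -/
theorem posSemidef_of_tendsto {ι κ : Type*} {F : Filter κ} [F.NeBot] {M : κ → Matrix ι ι ℂ}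
    {A : Matrix ι ι ℂ} (hlim : ∀ i j, Tendsto (fun d => M d i j) F (𝓝 (A i j)))
    (h : ∀ s : Finset ι, ∀ᶠ d in F,
      ((M d).submatrix (Subtype.val : s → ι) Subtype.val).PosSemidef) : A.PosSemidef := by
  classical
  refine ⟨?_, fun x => ?_⟩
  · ext i j
    refine tendsto_nhds_unique ((hlim j i).star.congr' ?_) (hlim i j)
    -- The section on `{i, j}` already shows the symmetry of these two entries.
    filter_upwards [h {i, j}] with d hd
    exact hd.1.apply ⟨i, by simp⟩ ⟨j, by simp⟩
  · refine ge_of_tendsto (x := F) (f := fun d => x.sum fun i xi => x.sum fun j xj =>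
      star xi * M d i j * xj) ?_ ?_
    · exact tendsto_finsetSum _ fun i _ => tendsto_finsetSum _ fun j _ =>
        ((hlim i j).const_mul _).mul_const _
    · filter_upwards [h x.support] with d hd
      have h2 := hd.dotProduct_mulVec_nonneg fun k => x k.1
      simp only [dotProduct, Matrix.mulVec, Matrix.submatrix_apply, Pi.star_apply,
        Finset.mul_sum] at h2
      rw [Finset.sum_coe_sort x.support fun i => ∑ j : x.support, star (x i) * (M d i j * x j)]
        at h2
      convert h2 using 1
      refine Finset.sum_congr rfl fun i _ => ?_
      rw [Finset.sum_coe_sort x.support fun j => star (x i) * (M d i j * x j)]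
      exact Finset.sum_congr rfl fun j _ => mul_assoc _ _ _

theorem exists_length_bound {κ : Type*} (s : Finset (Word g × κ)) :
    ∃ N, ∀ k ∈ s, k.1.length ≤ N :=
  ⟨s.sup fun k => k.1.length, fun _ hk => Finset.le_sup (f := fun k => k.1.length) hk⟩

/-- A compactness argument. For each word the moments chosen at level `d` stay in a fixed ball once
`d` is at least the length plus `D`. One free ultrafilter makes all of them converge at once, in
place of a diagonal subsequence, and each finite section is positive semidefinite from some level
on. -/
theorem iInter_truncLiftProj_subset {p : MatPoly g ℓ ℓ} (hp : IsArchimedean p) (n : ℕ) :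
    ⋂ d, truncLiftProj p d n ⊆ liftProj p n := by
  intro X hX
  choose W h1 hs hH hL hWX using fun d => mem_truncLiftProj_iff.1 (Set.mem_iInter.1 hX d)
  obtain ⟨D, C, hC⟩ := exists_moment_bound hp
  let F : Ultrafilter ℕ := hyperfilter ℕ
  have hF : ∀ N, ∀ᶠ d in (F : Filter ℕ), N ≤ d := fun N =>
    Nat.hyperfilter_le_atTop (eventually_ge_atTop N)
  have hlim : ∀ w i j, ∃ z, Tendsto (fun d => W d w i j) F (𝓝 z) := by
    intro w i j
    have hb : ∀ᶠ d in (F : Filter ℕ), W d w i j ∈ Metric.closedBall (0 : ℂ) (C w) := by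
      filter_upwards [hF (w.length + D)] with d hd
      rw [mem_closedBall_zero_iff]
      exact hC n w (W d) (h1 d) (hs d) (hankelSection_of_le (by omega) (hH d))
        (localizingSection_of_le hd (hL d)) i j
    obtain ⟨z, -, hz⟩ := (isCompact_closedBall (0 : ℂ) (C w)).ultrafilter_le_nhds
      (F.map fun d => W d w i j) (le_principal_iff.2 hb)
    exact ⟨z, hz⟩
  choose y hy using hlim
  -- Moments that do not vary with `d` pass to the limit unchanged; this covers the empty word and
  -- the letters, so the limit still projects to `X`.
  have hconst : ∀ (w : Word g) (A : Matrix (Fin n) (Fin n) ℂ), (∀ d, W d w = A) →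
      Matrix.of (y w) = A := by
    intro w A hA
    ext i j
    refine tendsto_nhds_unique (hy w i j) ?_
    simp only [hA]
    exact tendsto_const_nhds
  refine ⟨fun w => Matrix.of (y w), ⟨hconst 1 1 h1, fun α => ?_, ?_, ?_⟩, fun j =>
    (hconst _ _ fun d => (hWX d j).symm).symm⟩
  · ext i j
    refine tendsto_nhds_unique (hy (star α) i j) ?_
    simp only [hs]
    exact (hy α j i).star
  · refine posSemidef_of_tendsto (F := F) (M := fun d => hankel (W d))
      (fun r c => hy (star r.1 * c.1) r.2 c.2)
      fun s => ?_
    obtain ⟨N, hN⟩ := exists_length_bound s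
    filter_upwards [hF N] with d hd
    exact (hankelSection_of_le (N := N) (by omega) (hH d)).submatrix
      fun k : s => (⟨k.1.1, hN k.1 k.2⟩, k.1.2)
  · refine posSemidef_of_tendsto (F := F) (M := fun d => localizing p (W d)) (fun r c => ?_)
      fun s => ?_
    · simp only [localizing, Matrix.of_apply, Matrix.sum_apply, Matrix.kroneckerMap_apply]
      exact tendsto_finsetSum _ fun γ _ => (hy _ _ _).const_mul _
    · obtain ⟨N, hN⟩ := exists_length_bound s
      filter_upwards [hF N] with d hd
      exact (localizingSection_of_le hd (hL d)).submatrix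
        fun k : s => (⟨k.1.1, hN k.1 k.2⟩, k.1.2)

end Limits

/-! ### The truncated lift as a projected spectrahedron -/

theorem posSemidef_fromBlocks_zero_iff {κ μ : Type*} [Fintype κ] [Fintype μ]
    {A : Matrix κ κ ℂ} {B : Matrix μ μ ℂ} :
    (Matrix.fromBlocks A 0 0 B).PosSemidef ↔ A.PosSemidef ∧ B.PosSemidef := by
  refine ⟨fun h => ⟨h.submatrix Sum.inl, h.submatrix Sum.inr⟩, fun ⟨hA, hB⟩ => ?_⟩
  refine Matrix.PosSemidef.of_dotProduct_mulVec_nonneg ?_ fun x => ?_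
  · rw [Matrix.IsHermitian, Matrix.fromBlocks_conjTranspose, hA.1.eq, hB.1.eq,
      Matrix.conjTranspose_zero, Matrix.conjTranspose_zero]
  · have h := add_nonneg (hA.dotProduct_mulVec_nonneg (x ∘ Sum.inl))
      (hB.dotProduct_mulVec_nonneg (x ∘ Sum.inr))
    convert h using 1
    simp [Matrix.fromBlocks_mulVec, dotProduct, Fintype.sum_sum_type]

theorem sum_ite_word {N : ℕ} {v : Word g} (hv : v.length ≤ N) (c : ℂ) (f : TruncWord g N → ℂ) :
    ∑ σ : TruncWord g N, (if v = σ.1 then c else 0) * f σ = c * f ⟨v, hv⟩ := by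
  rw [Finset.sum_eq_single ⟨v, hv⟩]
  · simp
  · intro σ _ hσ
    rw [if_neg fun h => hσ (Subtype.ext h.symm), zero_mul]
  · simp

/-- The pencil of the truncated lift, before its splitting into self-adjoint variables. -/
def momPencil (p : MatPoly g ℓ ℓ) (d : ℕ)
    (Y : TruncWord g (momLen p d) → Matrix (Fin n) (Fin n) ℂ) :
    Matrix (PencilIndex p d × Fin n) (PencilIndex p d × Fin n) ℂ :=
  ∑ σ, momCoef p d σ.1 ⊗ₖ Y σ

/-- At a given entry, `momCoef` selects exactly the moments occurring there, with their
coefficients. The reindexing only distributes `Fin n` over the two blocks. -/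
theorem momPencil_eq (p : MatPoly g ℓ ℓ) (d : ℕ)
    (Y : TruncWord g (momLen p d) → Matrix (Fin n) (Fin n) ℂ) :
    momPencil p d Y = (Matrix.fromBlocks (truncHankel p d Y) 0 0 (truncLocalizing p d Y)).submatrix
      ((Equiv.sumProdDistrib _ _ _).trans ((Equiv.refl _).sumCongr (Equiv.prodAssoc _ _ _)))
      ((Equiv.sumProdDistrib _ _ _).trans ((Equiv.refl _).sumCongr (Equiv.prodAssoc _ _ _))) := by
  ext ⟨r, i⟩ ⟨c, j⟩
  rw [momPencil, Matrix.sum_apply]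
  rcases r with α | ⟨α, a⟩ <;> rcases c with β | ⟨β, b⟩
  · simp only [Matrix.kroneckerMap_apply, momCoef, Matrix.fromBlocks_apply₁₁, Matrix.of_apply]
    rw [sum_ite_word, one_mul]
    rfl
  · simp [momCoef]
  · simp [momCoef]
  · simp only [Matrix.kroneckerMap_apply, momCoef, Matrix.fromBlocks_apply₂₂, Matrix.of_apply,
      Finset.sum_mul]
    rw [Finset.sum_comm]
    have hlen : ∀ γ : TruncWord g (degree p),
        (star α.1 * γ.1 * β.1).length ≤ momLen p d := fun γ => by
      have h1 := α.2
      have h2 := β.2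
      have h3 := γ.2
      rw [FreeMonoid.length_mul, FreeMonoid.length_mul, length_star]
      unfold momLen
      omega
    simp only [fun γ => sum_ite_word (hlen γ)]
    simp [truncLocalizing, Matrix.sum_apply]

theorem momPencil_posSemidef_iff {p : MatPoly g ℓ ℓ} {d : ℕ}
    {Y : TruncWord g (momLen p d) → Matrix (Fin n) (Fin n) ℂ} :
    (momPencil p d Y).PosSemidef ↔
      (truncHankel p d Y).PosSemidef ∧ (truncLocalizing p d Y).PosSemidef := by
  rw [momPencil_eq, Matrix.posSemidef_submatrix_equiv, posSemidef_fromBlocks_zero_iff]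

/-- The words that index a truncated moment sequence are the empty word, the letters and the words of
length at least two. -/
def wordSplit (p : MatPoly g ℓ ℓ) (d : ℕ) :
    (Unit ⊕ Fin g) ⊕ HighWord p d → TruncWord g (momLen p d) :=
  Sum.elim (Sum.elim (fun _ => TruncWord.empty g _) (momLetter p d)) Subtype.val

theorem wordSplit_bijective (p : MatPoly g ℓ ℓ) (d : ℕ) : Function.Bijective (wordSplit p d) := by
  constructor
  · intro x y h
    have hlen : (wordSplit p d x).1.length = (wordSplit p d y).1.length := by rw [h]
    have l0 : (TruncWord.empty g (momLen p d)).1.length = 0 := rfl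
    have l1 : ∀ j, (momLetter p d j).1.length = 1 := fun _ => rfl
    rcases x with (x | x) | x <;> rcases y with (y | y) | y <;>
      simp only [wordSplit, Sum.elim_inl, Sum.elim_inr, l0, l1] at hlen h
    · rfl
    · omega
    · have := y.2
      omega
    · omega
    · rw [FreeMonoid.of_injective (congrArg Subtype.val h)]
    · have := y.2
      omega
    · have := x.2
      omega
    · have := x.2
      omega
    · rw [Subtype.ext h]
  · intro σ
    by_cases h0 : σ.1.length = 0
    · exact ⟨Sum.inl (Sum.inl ()), Subtype.ext (FreeMonoid.length_eq_zero.1 h0).symm⟩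
    by_cases h1 : σ.1.length = 1
    · obtain ⟨j, hj⟩ := FreeMonoid.length_eq_one.1 h1
      exact ⟨Sum.inl (Sum.inr j), Subtype.ext hj.symm⟩
    · exact ⟨Sum.inr ⟨σ, by omega⟩, rfl⟩

theorem sum_truncWord_eq {M : Type*} [AddCommMonoid M] (p : MatPoly g ℓ ℓ) (d : ℕ)
    (f : TruncWord g (momLen p d) → M) :
    ∑ σ, f σ = f (TruncWord.empty g _) + ∑ j, f (momLetter p d j) +
      ∑ σ : HighWord p d, f σ.1 := by
  rw [← Fintype.sum_bijective _ (wordSplit_bijective p d) (fun x => f (wordSplit p d x)) f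
    fun _ => rfl]
  simp [wordSplit, Fintype.sum_sum_type]

/-- Word reversal on the words of length at least two. -/
def highRev (p : MatPoly g ℓ ℓ) (d : ℕ) : HighWord p d ≃ HighWord p d where
  toFun σ := ⟨σ.1.rev, σ.2.trans_eq (length_star σ.1.1).symm⟩
  invFun σ := ⟨σ.1.rev, σ.2.trans_eq (length_star σ.1.1).symm⟩
  left_inv σ := Subtype.ext σ.1.rev_rev
  right_inv σ := Subtype.ext σ.1.rev_rev

/-- The terms of `σ` regroup as half of `E_σ ⊗ (u_σ + i v_σ) + E_σ^* ⊗ (u_σ - i v_σ)`. Since `E_σ^*`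
is the coefficient of the reversed word, reindexing the second part by reversal leaves at `E_σ` the
average in `hY`. -/
theorem lassPencil_eval {p : MatPoly g ℓ ℓ} (hp : p.IsHermitian) (d : ℕ)
    (X : Fin g → Matrix (Fin n) (Fin n) ℂ) (u v : HighWord p d → Matrix (Fin n) (Fin n) ℂ)
    {Y : TruncWord g (momLen p d) → Matrix (Fin n) (Fin n) ℂ}
    (h1 : Y (TruncWord.empty g _) = 1) (hX : ∀ j, X j = Y (momLetter p d j))
    (hY : ∀ σ : HighWord p d, Y σ.1 = (1 / 2 : ℂ) • ((u σ + Complex.I • v σ) +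
      (u (highRev p d σ) - Complex.I • v (highRev p d σ)))) :
    (lassPencil p hp d).eval (Sum.elim X (Sum.elim u v)) = momPencil p d Y := by
  rw [momPencil, sum_truncWord_eq, LinearPencil.eval, Fintype.sum_sum_type, Fintype.sum_sum_type,
    h1, ← add_assoc]
  congr 1
  · simp [lassPencil, hX, TruncWord.empty, momLetter]
  have hrev : ∑ σ : HighWord p d, momCoef p d (star σ.1.1) ⊗ₖ ((1 / 2 : ℂ) •
        (u σ - Complex.I • v σ)) =
      ∑ σ : HighWord p d, momCoef p d σ.1.1 ⊗ₖ ((1 / 2 : ℂ) •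
        (u (highRev p d σ) - Complex.I • v (highRev p d σ))) := by
    refine Fintype.sum_equiv (highRev p d) _ _ fun σ => ?_
    change _ = momCoef p d (star σ.1.1) ⊗ₖ _
    rw [show highRev p d (highRev p d σ) = σ from (highRev p d).left_inv σ]
  have hsplit : ∀ σ : HighWord p d, momCoef p d σ.1.1 ⊗ₖ Y σ.1 =
      momCoef p d σ.1.1 ⊗ₖ ((1 / 2 : ℂ) • (u σ + Complex.I • v σ)) +
      momCoef p d σ.1.1 ⊗ₖ ((1 / 2 : ℂ) •
        (u (highRev p d σ) - Complex.I • v (highRev p d σ))) := fun σ => by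
    rw [hY, smul_add, Matrix.kronecker_add]
  simp only [hsplit, Finset.sum_add_distrib]
  rw [← hrev, ← Finset.sum_add_distrib, ← Finset.sum_add_distrib]
  refine Finset.sum_congr rfl fun σ _ => ?_
  simp only [lassPencil, Sum.elim_inl, Sum.elim_inr, momCoef_conjTranspose hp]
  ext r c
  simp only [Matrix.add_apply, Matrix.sub_apply, Matrix.kroneckerMap_apply, Matrix.smul_apply,
    smul_eq_mul]
  ring

theorem truncLiftProj_eq_projX {p : MatPoly g ℓ ℓ} (hp : p.IsHermitian) (d n : ℕ) :
    truncLiftProj p d n = (lassPencil p hp d).projX n := by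
  ext X
  constructor
  · rintro ⟨Y, ⟨h1, hs, hH, hL⟩, hX⟩
    -- The self-adjoint real and imaginary parts of `Y σ`.
    refine ⟨Sum.elim (fun σ => (1 / 2 : ℂ) • (Y σ.1 + (Y σ.1)ᴴ))
      (fun σ => (-Complex.I / 2) • (Y σ.1 - (Y σ.1)ᴴ)), ?_, ?_⟩
    · rintro (j | σ | σ)
      · change (X j).IsHermitian
        rw [hX, Matrix.IsHermitian, ← hs]
        rfl
      · show (_)ᴴ = _
        simp [add_comm]
      · show (_)ᴴ = _
        simp only [Sum.elim_inr, Matrix.conjTranspose_smul, Matrix.conjTranspose_sub,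
          Matrix.conjTranspose_conjTranspose]
        rw [show star (-Complex.I / 2) = -(-Complex.I / 2) by simp [neg_div], neg_smul, ← smul_neg,
          neg_sub]
    · rw [lassPencil_eval hp d X _ _ h1 hX fun σ => ?_]
      · exact momPencil_posSemidef_iff.2 ⟨hH, hL⟩
      · have h : Y (highRev p d σ).1 = (Y σ.1)ᴴ := hs σ.1
        rw [h, Matrix.conjTranspose_conjTranspose]
        ext i j
        simp only [Matrix.add_apply, Matrix.sub_apply, Matrix.smul_apply, smul_eq_mul]
        linear_combination (1 / 2 : ℂ) * (Y σ.1 i j - (Y σ.1)ᴴ i j) * Complex.I_mul_I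
  · rintro ⟨W, hW, hpos⟩
    let u : HighWord p d → Matrix (Fin n) (Fin n) ℂ := fun σ => W (Sum.inl σ)
    let v : HighWord p d → Matrix (Fin n) (Fin n) ℂ := fun σ => W (Sum.inr σ)
    have hu : ∀ σ, (u σ)ᴴ = u σ := fun σ => hW (Sum.inr (Sum.inl σ))
    have hv : ∀ σ, (v σ)ᴴ = v σ := fun σ => hW (Sum.inr (Sum.inr σ))
    have hXh : ∀ j, (X j)ᴴ = X j := fun j => hW (Sum.inl j)
    have hWuv : W = Sum.elim u v := by
      ext1 (σ | σ) <;> rfl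
    -- The pencil imposes no relation between the variables of `σ` and of its reversal, so `u_σ + i
    -- v_σ` alone need not satisfy the symmetry of moments. This average does, and gives the same
    -- value of the pencil.
    let high : HighWord p d → Matrix (Fin n) (Fin n) ℂ := fun σ =>
      (1 / 2 : ℂ) • ((u σ + Complex.I • v σ) +
        (u (highRev p d σ) - Complex.I • v (highRev p d σ)))
    let Y : TruncWord g (momLen p d) → Matrix (Fin n) (Fin n) ℂ := fun σ =>
      Sum.elim (Sum.elim (fun _ => 1) X) high
        ((Equiv.ofBijective _ (wordSplit_bijective p d)).symm σ)
    have hY : ∀ x, Y (wordSplit p d x) = Sum.elim (Sum.elim (fun _ => 1) X) high x := fun x =>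
      congrArg _ ((Equiv.ofBijective _ (wordSplit_bijective p d)).symm_apply_apply x)
    have hYe : Y (TruncWord.empty g _) = 1 := hY (Sum.inl (Sum.inl ()))
    have hYx : ∀ j, X j = Y (momLetter p d j) := fun j => (hY (Sum.inl (Sum.inr j))).symm
    have hYh : ∀ σ : HighWord p d, Y σ.1 = high σ := fun σ => hY (Sum.inr σ)
    rw [hWuv, lassPencil_eval hp d X u v hYe hYx hYh, momPencil_posSemidef_iff] at hpos
    refine ⟨Y, ⟨hYe, fun α => ?_, hpos⟩, hYx⟩
    obtain ⟨((_ | j) | σ), rfl⟩ := (wordSplit_bijective p d).2 α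
    · change Y (TruncWord.empty g _) = (Y (TruncWord.empty g _))ᴴ
      rw [hYe, Matrix.conjTranspose_one]
    · change Y (momLetter p d j) = (Y (momLetter p d j))ᴴ
      rw [← hYx, hXh]
    · change Y (highRev p d σ).1 = (Y σ.1)ᴴ
      have hrr : highRev p d (highRev p d σ) = σ := (highRev p d).left_inv σ
      rw [hYh, hYh]
      simp only [high, hrr, Matrix.conjTranspose_smul, Matrix.conjTranspose_add,
        Matrix.conjTranspose_sub, hu, hv, Complex.star_def, Complex.conj_I]
      rw [show (starRingEnd ℂ) (1 / 2) = 1 / 2 by rw [map_div₀, map_one, Complex.conj_ofNat]]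
      congr 1
      module

end FreeHull
end

theorem corollary6p2 {g ℓ : ℕ} (p : FreeHull.MatPoly g ℓ ℓ) (hp : p.IsHermitian)
    (harch : FreeHull.IsArchimedean p) :
    (∀ n : ℕ, FreeHull.coOper p n = FreeHull.liftProj p n) ∧
    (∀ n : ℕ, (⋂ d : ℕ, FreeHull.truncLiftProj p d n) = FreeHull.coOper p n) ∧
    (∀ d n : ℕ, FreeHull.truncLiftProj p d n = (FreeHull.lassPencil p hp d).projX n) ∧
    (∀ d : ℕ, FreeHull.IsFreeSpectrahedrop (FreeHull.truncLiftProj p d)) ∧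
    (∀ d n : ℕ, FreeHull.coOper p n ⊆ FreeHull.truncLiftProj p d n) ∧
    (∀ n : ℕ, Antitone fun d : ℕ => FreeHull.truncLiftProj p d n) := by
  have h1 : ∀ n : ℕ, FreeHull.coOper p n = FreeHull.liftProj p n := fun n =>
    (FreeHull.coOper_subset_liftProj hp).antisymm (FreeHull.liftProj_subset_coOper harch)
  have h5 : ∀ d n : ℕ, FreeHull.coOper p n ⊆ FreeHull.truncLiftProj p d n := fun d n =>
    (h1 n).trans_subset (FreeHull.liftProj_subset_truncLiftProj p d n)
  refine ⟨h1, fun n => ?_, FreeHull.truncLiftProj_eq_projX hp, fun d => ?_, h5,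
    FreeHull.antitone_truncLiftProj p⟩
  · refine Set.Subset.antisymm ?_ (Set.subset_iInter fun d => h5 d n)
    rw [h1]
    exact FreeHull.iInter_truncLiftProj_subset harch n
  · exact ⟨_, _, inferInstance, inferInstance, FreeHull.lassPencil p hp d,
      funext fun n => FreeHull.truncLiftProj_eq_projX hp d n⟩
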